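/- Let $A\in\mathbb R^{N\times N}$ be stable (all eigenvalues in the open unit disc) and diagonalizable over $\mathbb C$, $A=V\Lambda U'$ with $U'V=I$, where $'$ denotes the transpose, $\Lambda=\mathrm{diag}(\lambda_1,\dots,\lambda_N)$, and the columns $V_i$, $U_i$ are right and left eigenvectors. Let $c,o\subseteq\{1,\dots,N\}$ be sets of modes and let $l=|c\cap o|$. For $\epsilon\in\mathbb R$ let $B_\epsilon\in\mathbb R^{N\times p}$ and $C_\epsilon\in\mathbb R^{q\times N}$ be such that $U_i'B_\epsilon$ is independent of $\epsilon$ for $i\in c$ and equals $\epsilon$ times a constant row vector for $i\notin c$, and $C_\epsilon V_i$ is independent of $\epsilon$ for $i\in o$ and equals $\epsilon$ times a constant vector for $i\notin o$. Assume that the $l$ modes in $c\cap o$ are controllable and observable: $w'B_0\ne0$ for every left eigenvector $w$ of $A$ in $\mathrm{span}\{U_i: i\in c\cap o\}$, and $C_0w\neq 0$ for every right eigenvector $w$ of $A$ in $\mathrm{span}\{V_i: i\in c\cap o\}$ (for distinct eigenvalues: $U_i'B_0\neq0$ and $C_0V_i\ne0$ for $i\in c\cap o$). Let $(u_k)$ and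 $(v_k)$ be Gaussian white noises with values in $\mathbb R^p$ and $\mathbb R^q$ (all components at all times independent, centred, with a common positive variance). Let $X_r=(x_{t_1}\cdots x_{t_m})$ and $Z_r=(z_{\hat t_1}\cdots z_{\hat t_n})$ consist of snapshots of $$x_k=Ax_{k-1}+B_\epsilon u_k,\quad x_0=0,\qquad z_k=A'z_{k-1}+C_\epsilon'v_k,\quad z_0=0,$$ at times $1\le t_1<\dots<t_m$ and $1\le\hat t_1<\dots<\hat t_n$, where $m,n\ge l$. The RPOD$^*$ algorithm takes a singular value decomposition of $Z_r'X_r$, keeps its first (largest) $l$ singular values, which have to be nonzero, in $\Sigma_r$, with left and right singular vectors $L_r,R_r$, forms $T_r=X_rR_r\Sigma_r^{-1/2}$ and $S_r=\Sigma_r^{-1/2}L_r'Z_r'$, diagonalizes $S_rAT_r=P_r\Lambda_rP_r^{-1}$ (over $\mathbb C$), and returns $$A_r=P_r^{-1}S_rAT_rP_r,\qquad B_r=P_r^{-1}S_rB_\epsilon,\qquad C_r=C_\epsilon T_rP_r .$$ Then, almost surely, there are $K$ and $\epsilon_0>0$ (not depending on $\epsilon$, on $i$, or on the choices made in the algorithm)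 such that for all $|\epsilon|<\epsilon_0$: the matrix $Z_r'X_r$ has at least $l$ nonzero singular values; if the $\lambda_i$, $i\in c\cap o$, are pairwise distinct, the algorithm does return a model; and every model $(A_r,B_r,C_r)$ that the algorithm may return satisfies $$\|C_rA_r^iB_r-C_\epsilon A^iB_\epsilon\|\le K|\epsilon|\qquad\text{for all } i\ge 0,$$ where $\|\cdot\|$ is the spectral norm. -/

import Mathlib

open MeasureTheory ProbabilityTheory
open scoped NNReal Matrix Matrix.Norms.L2Operator

/-- A real matrix viewed as a complex matrix. -/
noncomputable abbrev cplx {m n : ℕ} (M : Matrix (Fin m) (Fin n) ℝ) : Matrix (Fin m) (Fin n) ℂ :=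
  M.map Complex.ofReal

/-- Stability of a discrete-time system matrix: all eigenvalues lie in the open unit disc. -/
def IsStableMatrix {N : ℕ} (A : Matrix (Fin N) (Fin N) ℝ) : Prop :=
  ∀ z ∈ spectrum ℂ (cplx A), ‖z‖ < 1

/-- `A = V Λ U'` with `U' V = 1`: the columns of `V` and of `U` are right and left eigenvectors
of `A`, normalized to be biorthogonal, and `lam` lists the eigenvalues. In particular
`A` is diagonalizable over `ℂ`. -/
structure IsEigendecomposition {N : ℕ} (A : Matrix (Fin N) (Fin N) ℝ)
    (V : Matrix (Fin N) (Fin N) ℂ) (lam : Fin N → ℂ) (U : Matrix (Fin N) (Fin N) ℂ) : Prop where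
  eq : cplx A = V * Matrix.diagonal lam * Uᵀ
  biorthogonal : Uᵀ * V = 1

/-- The modes in `s` are controllable: no left eigenvector of `A` in the span of the left
eigenvectors `U_i`, `i ∈ s`, is annihilated by `B`. If the eigenvalues of these modes are pairwise
distinct, this says `U_i' B ≠ 0` for all `i ∈ s`; for repeated eigenvalues it does not depend on
the choice of the eigenvectors inside the span. -/
def ControllableModes {N p : ℕ} (A : Matrix (Fin N) (Fin N) ℝ) (B : Matrix (Fin N) (Fin p) ℝ)
    (U : Matrix (Fin N) (Fin N) ℂ) (s : Finset (Fin N)) : Prop :=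
  ∀ w ∈ Submodule.span ℂ ((fun i => U.col i) '' (s : Set (Fin N))), w ≠ 0 →
    (∃ z : ℂ, w ᵥ* cplx A = z • w) → w ᵥ* cplx B ≠ 0

/-- The modes in `s` are observable: no right eigenvector of `A` in the span of the right
eigenvectors `V_i`, `i ∈ s`, is annihilated by `C`. -/
def ObservableModes {N q : ℕ} (A : Matrix (Fin N) (Fin N) ℝ) (C : Matrix (Fin q) (Fin N) ℝ)
    (V : Matrix (Fin N) (Fin N) ℂ) (s : Finset (Fin N)) : Prop :=
  ∀ w ∈ Submodule.span ℂ ((fun i => V.col i) '' (s : Set (Fin N))), w ≠ 0 →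
    (∃ z : ℂ, cplx A *ᵥ w = z • w) → cplx C *ᵥ w ≠ 0

/-- The input matrices `B ε` couple to the modes outside `c` (the nearly uncontrollable ones) by
`ε` times a constant matrix, and to the modes in `c` independently of `ε`. -/
structure NearlyUncontrollable {N p : ℕ} (U : Matrix (Fin N) (Fin N) ℂ) (c : Finset (Fin N))
    (B : ℝ → Matrix (Fin N) (Fin p) ℝ) : Prop where
  small : ∃ K : Matrix (Fin N) (Fin p) ℂ,
    ∀ ε : ℝ, ∀ i ∉ c, ∀ j, (Uᵀ * cplx (B ε)) i j = (ε : ℂ) * K i j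
  const : ∀ ε : ℝ, ∀ i ∈ c, ∀ j, (Uᵀ * cplx (B ε)) i j = (Uᵀ * cplx (B 0)) i j

/-- The output matrices `C ε` couple to the modes outside `o` (the nearly unobservable ones) by
`ε` times a constant matrix, and to the modes in `o` independently of `ε`. -/
structure NearlyUnobservable {N q : ℕ} (V : Matrix (Fin N) (Fin N) ℂ) (o : Finset (Fin N))
    (C : ℝ → Matrix (Fin q) (Fin N) ℝ) : Prop where
  small : ∃ K : Matrix (Fin q) (Fin N) ℂ,
    ∀ ε : ℝ, ∀ i ∉ o, ∀ j, (cplx (C ε) * V) j i = (ε : ℂ) * K j i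
  const : ∀ ε : ℝ, ∀ i ∈ o, ∀ j, (cplx (C ε) * V) j i = (cplx (C 0) * V) j i

/-- Gaussian white noise with values in `ℝ^p`: all components at all times are independent,
centred Gaussian with the same variance `r > 0`. -/
structure IsGaussianWhiteNoise {Ω : Type*} [MeasurableSpace Ω] (μ : Measure Ω) {p : ℕ}
    (u : ℕ → Ω → Fin p → ℝ) (r : ℝ≥0) : Prop where
  variance_pos : 0 < r
  law : ∀ k j, HasLaw (fun ω => u k ω j) (gaussianReal 0 r) μ
  indep : iIndepFun (fun (kj : ℕ × Fin p) ω => u kj.1 ω kj.2) μ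

/-- The trajectory `x_0 = 0`, `x_k = A x_{k-1} + B u_k`. -/
def trajectory {N p : ℕ} (A : Matrix (Fin N) (Fin N) ℝ) (B : Matrix (Fin N) (Fin p) ℝ)
    (u : ℕ → Fin p → ℝ) : ℕ → Fin N → ℝ
  | 0 => 0
  | k + 1 => A *ᵥ trajectory A B u k + B *ᵥ u (k + 1)

/-- The snapshot ensemble `(x_{t_1} ⋯ x_{t_m})` of the forced system. -/
def snapshots {N p m : ℕ} (A : Matrix (Fin N) (Fin N) ℝ) (B : Matrix (Fin N) (Fin p) ℝ)
    (u : ℕ → Fin p → ℝ) (t : Fin m → ℕ) : Matrix (Fin N) (Fin m) ℝ :=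
  Matrix.of fun i k => trajectory A B u (t k) i

/-- `H = L S R'` is a singular value decomposition: `L`, `R` are orthogonal and `S` is the
rectangular diagonal matrix with diagonal `s 0 ≥ s 1 ≥ ⋯ ≥ 0`. -/
structure IsSVD {n m : ℕ} (H : Matrix (Fin n) (Fin m) ℝ) (L : Matrix (Fin n) (Fin n) ℝ)
    (s : ℕ → ℝ) (R : Matrix (Fin m) (Fin m) ℝ) : Prop where
  left_orthogonal : Lᵀ * L = 1
  right_orthogonal : Rᵀ * R = 1
  antitone : Antitone s
  nonneg : ∀ k, 0 ≤ s k
  eq : H = L * (Matrix.of fun (i : Fin n) (j : Fin m) => if (i : ℕ) = j then s i else 0) * Rᵀ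

/-- The basis `T_r = X_r R_r Σ_r^{-1/2}`, where `R_r` consists of the first `l` columns of `R`. -/
noncomputable def podT {N m l : ℕ} (hm : l ≤ m) (X : Matrix (Fin N) (Fin m) ℝ) (s : ℕ → ℝ)
    (R : Matrix (Fin m) (Fin m) ℝ) : Matrix (Fin N) (Fin l) ℝ :=
  X * R.submatrix id (Fin.castLE hm) * Matrix.diagonal fun k : Fin l => (√(s k))⁻¹

/-- The basis `S_r = Σ_r^{-1/2} L_r' Z_r'`, where `L_r` consists of the first `l` columns of `L`. -/
noncomputable def podS {N n l : ℕ} (hn : l ≤ n) (Z : Matrix (Fin N) (Fin n) ℝ) (s : ℕ → ℝ)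
    (L : Matrix (Fin n) (Fin n) ℝ) : Matrix (Fin l) (Fin N) ℝ :=
  (Matrix.diagonal fun k : Fin l => (√(s k))⁻¹) * (L.submatrix id (Fin.castLE hn))ᵀ * Zᵀ

/-- `(Ar, Br, Cr)` is a reduced order model that the RPOD* algorithm may return for the system
`(A, B, C)` and the snapshot ensembles `X` (primal) and `Z` (adjoint) when the first `l` singular
values of `Z' X`, which have to be nonzero, are kept. The singular value decomposition and the
eigenvector matrix `P` of `S_r A T_r` are not unique: every choice is admitted. -/
def IsRPODStarROM {N p q m n l : ℕ} (hm : l ≤ m) (hn : l ≤ n)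
    (A : Matrix (Fin N) (Fin N) ℝ) (B : Matrix (Fin N) (Fin p) ℝ) (C : Matrix (Fin q) (Fin N) ℝ)
    (X : Matrix (Fin N) (Fin m) ℝ) (Z : Matrix (Fin N) (Fin n) ℝ)
    (Ar : Matrix (Fin l) (Fin l) ℂ) (Br : Matrix (Fin l) (Fin p) ℂ)
    (Cr : Matrix (Fin q) (Fin l) ℂ) : Prop :=
  ∃ (L : Matrix (Fin n) (Fin n) ℝ) (s : ℕ → ℝ) (R : Matrix (Fin m) (Fin m) ℝ)
    (P : Matrix (Fin l) (Fin l) ℂ) (lamr : Fin l → ℂ),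
    IsSVD (Zᵀ * X) L s R ∧ (∀ k < l, 0 < s k) ∧ IsUnit P ∧
    cplx (podS hn Z s L * A * podT hm X s R) = P * Matrix.diagonal lamr * P⁻¹ ∧
    Ar = (P⁻¹ * cplx (podS hn Z s L)) * cplx A * (cplx (podT hm X s R) * P) ∧
    Br = (P⁻¹ * cplx (podS hn Z s L)) * cplx B ∧
    Cr = cplx C * (cplx (podT hm X s R) * P)

/-! In modal coordinates the snapshots are `Uᵀ X = x₀ + ε x₁` and `Vᵀ Z = z₀ + ε z₁`, with `x₀`
supported on the rows in `c` and `z₀` on those in `o`. In `Zᵀ Aⁱ X = (Vᵀ Z)ᵀ Λⁱ (Uᵀ X)` only the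
modes in `c ∩ o` survive at order zero, so `Zᵀ X`, `Zᵀ A X`, `Zᵀ B`, `C X` and `C Aⁱ B` lie within
`O(ε)` of products `Z₀ X₀`, `Z₀ D X₀`, `Z₀ B₀`, `C₀ X₀`, `C₀ Dⁱ B₀` through `ℂ^l`, uniformly in `i`
(`exists_norm_modal_sub_le`).

The Markov parameters of a returned model are `(C X) E (E' (Zᵀ A X) E)ⁱ E' (Zᵀ B)`, where `E`, `E'`
are the scaled singular vectors and `E' (Zᵀ X) E = 1`; the eigenvector matrix `P` cancels. For
exactly factored data `X₀ E` is a similarity from the reduced dynamics to `D`. For nearby data it is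
an approximate one, and `‖D‖ < 1` makes the error uniform in the power
(`norm_reduced_markov_sub_le`). Near a `D` with simple spectrum the reduced dynamics is
diagonalizable, so a model exists.

All this needs `E` and `E'` bounded independently of `ε` and of the chosen decomposition, that is,
the first `l` singular values bounded below. That follows from one-sided inverses of `X₀` and `Z₀`
(`one_le_norm_one_sub_add_singularValue`). Such inverses exist almost surely: an `l × l` minor is a
polynomial in the noise, and controllability supplies an input at which it does not vanish
(`exists_linearIndependent_modalState`, `ae_eval_ne_zero`). -/

/-! ### Diagonal systems -/

/-- The trajectory of the diagonal system `x_0 = 0`, `x_k = d * x_{k-1} + b u_k`. -/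
def modalState {R ι κ : Type*} [CommRing R] [Fintype κ] (d : ι → R) (b : Matrix ι κ R)
    (u : ℕ → κ → R) : ℕ → ι → R
  | 0 => 0
  | k + 1 => d * modalState d b u k + b *ᵥ u (k + 1)

/-- Allows the state to be computed with indeterminates as inputs and then evaluated at the noise.
-/
theorem map_modalState {R S ι κ : Type*} [CommRing R] [CommRing S] [Fintype κ] (φ : R →+* S)
    (d : ι → R) (b : Matrix ι κ R) (u : ℕ → κ → R) (k : ℕ) (i : ι) :
    φ (modalState d b u k i) =
      modalState (fun i => φ (d i)) (b.map φ) (fun k j => φ (u k j)) k i := by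
  induction k generalizing i with
  | zero => simp [modalState]
  | succ k ih =>
    simp [modalState, ih, RingHom.map_mulVec, Function.comp_def]

theorem modalState_add_single {R ι κ : Type*} [CommRing R] [Fintype κ] (d : ι → R)
    (b : Matrix ι κ R) (u : ℕ → κ → R) {τ : ℕ} (hτ : 1 ≤ τ) (g : κ → R) (k : ℕ) :
    modalState d b (u + Pi.single τ g) k =
      modalState d b u k + if τ ≤ k then d ^ (k - τ) * (b *ᵥ g) else 0 := by
  induction k with
  | zero => simp [modalState, show ¬ τ ≤ 0 by omega]
  | succ k ih =>
    simp only [modalState, ih, Pi.add_apply, Matrix.mulVec_add]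
    rcases lt_trichotomy τ (k + 1) with h | h | h
    · rw [if_pos (by omega), if_pos (by omega), Pi.single_eq_of_ne (by omega),
        show k + 1 - τ = (k - τ) + 1 by omega]
      simp only [Matrix.mulVec_zero]; ring
    · subst h
      simp; ring
    · rw [if_neg (by omega), if_neg (by omega), Pi.single_eq_of_ne (by omega)]
      simp

/-! ### Reachability and inputs with independent snapshots -/

/-- The span of `d ^ i * b_j`, `i < a`: the states reachable in `a` steps. -/
def krylovSpace {ι κ : Type*} (d : ι → ℂ) (b : Matrix ι κ ℂ) (a : ℕ) : Submodule ℂ (ι → ℂ) :=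
  Submodule.span ℂ {x | ∃ i < a, ∃ j, x = d ^ i * b.col j}

theorem krylovSpace_mono {ι κ : Type*} (d : ι → ℂ) (b : Matrix ι κ ℂ) : Monotone (krylovSpace d b) := by
  intro a a' h
  apply Submodule.span_mono
  rintro x ⟨i, hi, j, rfl⟩
  exact ⟨i, by omega, j, rfl⟩

theorem mul_mem_krylovSpace {ι κ : Type*} (d : ι → ℂ) (b : Matrix ι κ ℂ) {a : ℕ} {x : ι → ℂ}
    (hx : x ∈ krylovSpace d b a) : d * x ∈ krylovSpace d b (a + 1) := by
  have : krylovSpace d b a ≤ (krylovSpace d b (a + 1)).comap (LinearMap.mulLeft ℂ d) := by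
    rw [krylovSpace, Submodule.span_le]
    rintro x ⟨i, hi, j, rfl⟩
    refine Submodule.subset_span ⟨i + 1, by omega, j, ?_⟩
    simp only [LinearMap.mulLeft_apply]
    ring
  exact this hx

section Krylov

variable {ι κ : Type*} [Fintype ι]

/-- Hautus test. Multiplication by `d` is symmetric for the dot product, so the annihilator of `W`
is invariant too. If it were nonzero it would contain an eigenvector, and that eigenvector would
kill every column of `b`. -/
theorem eq_top_of_invariant_of_controllable (d : ι → ℂ) (b : Matrix ι κ ℂ)
    (hb : ∀ y : ι → ℂ, y ≠ 0 → (∃ z : ℂ, d * y = z • y) → y ᵥ* b ≠ 0)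
    (W : Submodule ℂ (ι → ℂ)) (hd : ∀ x ∈ W, d * x ∈ W) (hW : ∀ j, b.col j ∈ W) : W = ⊤ := by
  classical
  by_contra hne
  let D : Submodule ℂ (ι → ℂ) :=
    { carrier := {y | ∀ x ∈ W, y ⬝ᵥ x = 0}
      add_mem' := fun {y z} hy hz x hx => by rw [add_dotProduct, hy x hx, hz x hx, add_zero]
      zero_mem' := fun x _ => zero_dotProduct x
      smul_mem' := fun c y hy x hx => by rw [smul_dotProduct, hy x hx, smul_zero] }
  have hD : ∀ y ∈ D, LinearMap.mulLeft ℂ d y ∈ D := by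
    intro y hy x hx
    have := hy (d * x) (hd x hx)
    rw [← this]
    simp only [dotProduct, LinearMap.mulLeft_apply, Pi.mul_apply]
    exact Finset.sum_congr rfl fun i _ => by ring
  obtain ⟨f, hf0, hf⟩ := Submodule.exists_le_ker_of_lt_top W (lt_top_iff_ne_top.2 hne)
  have hfdot : ∀ x, (fun i => f (Pi.single i 1)) ⬝ᵥ x = f x := by
    intro x
    conv_rhs => rw [pi_eq_sum_univ' x]
    simp only [map_sum, map_smul, dotProduct, smul_eq_mul]
    refine Finset.sum_congr rfl fun i _ => ?_
    rw [mul_comm]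
  have hnt : Nontrivial D := by
    refine ⟨⟨⟨fun i => f (Pi.single i 1), fun x hx => by rw [hfdot]; exact hf hx⟩, 0, ?_⟩⟩
    intro h
    apply hf0
    ext x
    have h' : (fun i => f (Pi.single i 1)) = 0 := congrArg Subtype.val h
    simpa using congrFun h' x
  obtain ⟨z, hz⟩ := Module.End.exists_eigenvalue ((LinearMap.mulLeft ℂ d).restrict hD)
  obtain ⟨⟨y, hy⟩, hyz⟩ := hz.exists_hasEigenvector
  have hy0 : y ≠ 0 := fun h => hyz.2 (Subtype.ext h)
  refine hb y hy0 ⟨z, congrArg Subtype.val hyz.apply_eq_smul⟩ ?_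
  ext j
  exact hy _ (hW j)

/-- The dimension grows at every step until two consecutive spaces agree; that space is then
invariant and hence everything. -/
theorem min_le_finrank_krylovSpace (d : ι → ℂ) (b : Matrix ι κ ℂ)
    (hb : ∀ y : ι → ℂ, y ≠ 0 → (∃ z : ℂ, d * y = z • y) → y ᵥ* b ≠ 0) (a : ℕ) :
    min (Fintype.card ι) a ≤ Module.finrank ℂ (krylovSpace d b a) := by
  induction a with
  | zero => simp
  | succ a ih =>
    have hle := krylovSpace_mono d b (Nat.le_succ a)
    rcases hle.eq_or_lt with h | h
    · have htop : krylovSpace d b a = ⊤ := by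
        apply eq_top_of_invariant_of_controllable d b hb
        · intro x hx
          rw [h]
          exact mul_mem_krylovSpace d b hx
        · intro j
          rw [h]
          exact Submodule.subset_span ⟨0, by omega, j, by simp⟩
      rw [← Nat.succ_eq_add_one, ← h, htop]
      simp
    · have := Submodule.finrank_lt_finrank_of_lt h
      simp only [Nat.succ_eq_add_one] at this
      omega

/-- Induction on the number of snapshots. If the last one always fell into the span `W` of the
earlier independent ones, small impulses added to the input would push every reachable direction `d
^ a * b.col i` into `W`, whose dimension `k` is too small. -/
theorem exists_linearIndependent_modalState [Fintype κ] (d : ι → ℂ) (b : Matrix ι κ ℂ)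
    (hb : ∀ y : ι → ℂ, y ≠ 0 → (∃ z : ℂ, d * y = z • y) → y ᵥ* b ≠ 0) (k : ℕ)
    (hk : k ≤ Fintype.card ι) (t : Fin k → ℕ) (ht : StrictMono t) (ht1 : ∀ j, 1 ≤ t j) :
    ∃ u : ℕ → κ → ℝ,
      LinearIndependent ℂ fun j => modalState d b (fun τ i => (u τ i : ℂ)) (t j) := by
  classical
  induction k with
  | zero => exact ⟨0, linearIndependent_empty_type⟩
  | succ k ih =>
    obtain ⟨u, hu⟩ := ih (by omega) (fun j => t j.castSucc)
      (fun i j h => ht (Fin.castSucc_lt_castSucc_iff.2 h)) (fun j => ht1 _)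
    by_contra! hdep
    set x : (ℕ → κ → ℝ) → ℕ → ι → ℂ := fun u => modalState d b (fun τ i => (u τ i : ℂ)) with hx
    let W : (ℕ → κ → ℝ) → Submodule ℂ (ι → ℂ) := fun u =>
      Submodule.span ℂ (Set.range fun j : Fin k => x u (t j.castSucc))
    have hlast : ∀ u', LinearIndependent ℂ (fun j : Fin k => x u' (t j.castSucc)) →
        x u' (t (Fin.last k)) ∈ W u' := by
      intro u' hu'
      by_contra hmem
      exact hdep u' (linearIndependent_finSucc'.2 ⟨hu', hmem⟩)
    have hpert : ∀ τ ≥ 1, ∀ i (s : ℝ) k, x (u + Pi.single τ (Pi.single i s)) k =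
        x u k + (s : ℂ) • if τ ≤ k then d ^ (k - τ) * b.col i else 0 := by
      intro τ hτ i s k
      have h1 : (fun τ' i' => (((u + Pi.single τ (Pi.single i s) : ℕ → κ → ℝ) τ' i' : ℝ) : ℂ)) =
          (fun τ' i' => (u τ' i' : ℂ)) + Pi.single τ (Pi.single i (s : ℂ)) := by
        ext τ' i'
        by_cases h : τ' = τ
        · subst h
          by_cases h' : i' = i
          · subst h'; simp
          · simp [h']
        · simp [h]
      simp only [hx, h1]
      rw [modalState_add_single d b _ hτ]
      congr 1
      split_ifs
      · ext i'
        simp; ring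
      · simp
    have hmem : ∀ a < t (Fin.last k), ∀ i, d ^ a * b.col i ∈ W u := by
      intro a
      induction a using Nat.strong_induction_on with
      | _ a iha =>
        intro ha i
        -- An impulse at this time moves the last state by exactly `d ^ a * b.col i`.
        set τ := t (Fin.last k) - a with hτ
        have hτ1 : 1 ≤ τ := by omega
        have hcont : Continuous fun s : ℝ => fun j : Fin k =>
            x (u + Pi.single τ (Pi.single i s)) (t j.castSucc) := by
          simp only [hpert τ hτ1 i]
          fun_prop
        have hopen := (isOpen_setOfPred_linearIndependent (𝕜 := ℂ) (E := ι → ℂ)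
          (ι := Fin k)).preimage hcont
        have h0 : (0 : ℝ) ∈ (fun s : ℝ => fun j : Fin k =>
            x (u + Pi.single τ (Pi.single i s)) (t j.castSucc)) ⁻¹'
            {f : Fin k → ι → ℂ | LinearIndependent ℂ f} := by
          simpa [Set.mem_preimage] using hu
        obtain ⟨δ, hδ, hball⟩ := Metric.isOpen_iff.1 hopen 0 h0
        have hs : LinearIndependent ℂ fun j : Fin k =>
            x (u + Pi.single τ (Pi.single i (δ / 2))) (t j.castSucc) := by
          have : δ / 2 ∈ Metric.ball (0 : ℝ) δ := by
            rw [Metric.mem_ball, Real.dist_eq, sub_zero, abs_of_pos (by positivity)]; linarith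
          exact hball this
        -- Earlier snapshots see the impulse with a delay smaller than `a`, so by strong induction
        -- their change already lies in `W u`.
        have hW : W (u + Pi.single τ (Pi.single i (δ / 2))) ≤ W u := by
          rw [Submodule.span_le]
          rintro _ ⟨j, rfl⟩
          simp only [hpert τ hτ1]
          refine Submodule.add_mem _ (Submodule.subset_span ⟨j, rfl⟩) (Submodule.smul_mem _ _ ?_)
          split_ifs with h
          · have : t j.castSucc < t (Fin.last k) := ht (Fin.castSucc_lt_last j)
            exact iha _ (by omega) (by omega) i
          · exact Submodule.zero_mem _
        have h2 := hW (hlast _ hs)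
        rw [hpert τ hτ1, if_pos (by omega), show t (Fin.last k) - τ = a by omega] at h2
        have h3 := (Submodule.add_mem_iff_right _ (hlast u hu)).1 h2
        refine (Submodule.smul_mem_iff _ ?_).1 h3
        exact_mod_cast (by positivity : δ / 2 ≠ 0)
    have hle : krylovSpace d b (t (Fin.last k)) ≤ W u := by
      rw [krylovSpace, Submodule.span_le]
      rintro _ ⟨a, ha, i, rfl⟩
      exact hmem a ha i
    have h1 := Submodule.finrank_mono hle
    have h2 := min_le_finrank_krylovSpace d b hb (t (Fin.last k))
    have h3 : Module.finrank ℂ (W u) = k := by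
      simpa using finrank_span_eq_card hu
    -- As the times start at 1 and not 0, the last is at least `k + 1`: enough steps for a Krylov
    -- space of dimension `k + 1`.
    have h4 : ∀ j : Fin (k + 1), (j : ℕ) + 1 ≤ t j := by
      intro j
      obtain ⟨j, hj⟩ := j
      induction j with
      | zero => simpa using ht1 _
      | succ j ihj =>
        have := ihj (by omega)
        have h5 : t ⟨j, by omega⟩ < t ⟨j + 1, hj⟩ := ht (by simp)
        simp only at this ⊢
        omega
    have := h4 (Fin.last k)
    simp only [Fin.val_last] at this
    omega

end Krylov

/-! ### Polynomials in independent random variables -/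

theorem finite_setOf_eval_update_eq_zero {σ : Type*} [DecidableEq σ] (P : MvPolynomial σ ℂ)
    (a : σ → ℂ) (i : σ) {y₀ : ℝ}
    (h : MvPolynomial.eval (Function.update a i y₀) P ≠ 0) :
    {y : ℝ | MvPolynomial.eval (Function.update a i (y : ℂ)) P = 0}.Finite := by
  let p : Polynomial ℂ := MvPolynomial.aeval
    (Function.update (fun j => Polynomial.C (a j)) i Polynomial.X) P
  have hp : ∀ y : ℂ, p.eval y = MvPolynomial.eval (Function.update a i y) P := by
    intro y
    have h1 : p.eval y = Polynomial.evalRingHom y (MvPolynomial.eval₂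
        (algebraMap ℂ (Polynomial ℂ))
        (Function.update (fun j => Polynomial.C (a j)) i Polynomial.X) P) := rfl
    rw [h1, MvPolynomial.hom_eval₂, MvPolynomial.eval, MvPolynomial.coe_eval₂Hom]
    congr 1
    · ext z; simp
    · ext j
      by_cases hj : j = i
      · subst hj; simp
      · simp [hj]
  have hp0 : p ≠ 0 := by
    intro h0
    apply h
    rw [← hp, h0, Polynomial.eval_zero]
  have := (Polynomial.finite_setOfPred_isRoot hp0).preimage
    (f := fun y : ℝ => (y : ℂ)) Complex.ofReal_injective.injOn
  refine this.subset fun y hy => ?_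
  simpa [Polynomial.IsRoot, hp] using hy

/-- A polynomial in independent random variables with atomless laws is almost surely nonzero, unless
it vanishes identically. -/
theorem ae_eval_ne_zero {σ Ω : Type*} [MeasurableSpace Ω] {μ : Measure Ω} [IsProbabilityMeasure μ]
    {f : σ → Ω → ℝ} (hf : iIndepFun f μ) (hm : ∀ i, AEMeasurable (f i) μ)
    (hna : ∀ i, NullSingletonClass (μ.map (f i))) (P : MvPolynomial σ ℂ) {a : σ → ℝ}
    (ha : MvPolynomial.eval (fun i => (a i : ℂ)) P ≠ 0) :
    ∀ᵐ ω ∂μ, MvPolynomial.eval (fun i => (f i ω : ℂ)) P ≠ 0 := by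
  classical
  -- The deterministic values `a` are replaced by the random ones one variable at a time. By Fubini,
  -- each replacement excludes only finitely many values of the new variable for almost every choice
  -- of the old ones.
  have key : ∀ S : Finset σ,
      ∀ᵐ ω ∂μ, MvPolynomial.eval (fun i => if i ∈ S then (f i ω : ℂ) else a i) P ≠ 0 := by
    intro S
    induction S using Finset.induction_on with
    | empty => simpa using ha
    | insert i S hi ih =>
      have hind : IndepFun (fun ω (j : S) => f j ω) (f i) μ := by
        have h := hf.indepFun_finset₀ S {i} (by simpa using hi) hm
        exact h.comp measurable_id
          (measurable_pi_apply (⟨i, Finset.mem_singleton_self i⟩ : ({i} : Finset σ)))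
      have hmS : AEMeasurable (fun ω (j : S) => f j ω) μ := aemeasurable_pi_lambda _ fun j => hm j
      let F : (S → ℝ) × ℝ → ℂ := fun x => MvPolynomial.eval
        (fun j => if h : j ∈ S then (x.1 ⟨j, h⟩ : ℂ) else if j = i then (x.2 : ℂ) else a j) P
      have hF : Continuous F := by
        refine (MvPolynomial.continuous_eval P).comp (continuous_pi fun j => ?_)
        split_ifs <;> fun_prop
      have hN : MeasurableSet {x | F x = 0} := hF.measurable (measurableSet_singleton 0)
      have hprod : (μ.map (fun ω (j : S) => f j ω)).prod (μ.map (f i)) {x | F x = 0} = 0 := by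
        rw [Measure.measure_prod_null hN]
        have h1 : ∀ᵐ x ∂(μ.map (fun ω (j : S) => f j ω)), F (x, a i) ≠ 0 := by
          rw [ae_map_iff hmS]
          · filter_upwards [ih] with ω hω
            convert hω using 3
            ext j
            simp only [dite_eq_ite]
            split_ifs with h1 h2
            · rfl
            · rw [h2]
            · rfl
          · have : Continuous fun x : S → ℝ => F (x, a i) := by fun_prop
            exact (this.measurable (measurableSet_singleton 0)).compl
        filter_upwards [h1] with x hx
        have hupd : ∀ y : ℝ, F (x, y) = MvPolynomial.eval (Function.update
            (fun j => if h : j ∈ S then (x ⟨j, h⟩ : ℂ) else a j) i (y : ℂ)) P := by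
          intro y
          simp only [F]
          congr 2
          ext j
          by_cases hj : j = i
          · subst hj; simp [hi]
          · simp [hj]
        have hfin := finite_setOf_eval_update_eq_zero P _ i ((hupd (a i)).symm.trans_ne hx)
        have := hna i
        refine measure_mono_null (fun y hy => ?_) (hfin.measure_zero _)
        have hy' : F (x, y) = 0 := hy
        rwa [hupd] at hy'
      rw [← hind.map_prod_eq_prod_map_map hmS (hm i)] at hprod
      have hae : ∀ᵐ x ∂(μ.map fun ω => ((fun j : S => f j ω), f i ω)), F x ≠ 0 := by
        rw [ae_iff]; simpa using hprod
      filter_upwards [ae_of_ae_map (hmS.prodMk (hm i)) hae] with ω hω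
      convert hω using 3
      ext j
      by_cases hj : j = i
      · subst hj; simp [hi]
      · simp [hj]
  -- Only the finitely many variables occurring in `P` have to be replaced.
  filter_upwards [key P.vars] with ω hω
  convert hω using 1
  refine MvPolynomial.eval₂Hom_congr' rfl (fun i hi _ => ?_) rfl
  simp [hi]

/-- The snapshots of a controllable diagonal system driven by white noise are almost surely
independent. -/
theorem ae_det_modalState_ne_zero {Ω : Type*} [MeasurableSpace Ω] {μ : Measure Ω}
    [IsProbabilityMeasure μ] {l p : ℕ} {u : ℕ → Ω → Fin p → ℝ} {r : ℝ≥0}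
    (hu : IsGaussianWhiteNoise μ u r) (d : Fin l → ℂ) (b : Matrix (Fin l) (Fin p) ℂ)
    (hb : ∀ y : Fin l → ℂ, y ≠ 0 → (∃ z : ℂ, d * y = z • y) → y ᵥ* b ≠ 0)
    (t : Fin l → ℕ) (ht : StrictMono t) (ht1 : ∀ j, 1 ≤ t j) :
    ∀ᵐ ω ∂μ, (Matrix.of fun i k =>
      modalState d b (fun τ j => (u τ ω j : ℂ)) (t k) i).det ≠ 0 := by
  obtain ⟨u₀, hu₀⟩ := exists_linearIndependent_modalState d b hb l (by simp) t ht ht1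
  let P : MvPolynomial (ℕ × Fin p) ℂ := (Matrix.of fun i k => modalState
    (fun i => MvPolynomial.C (d i)) (b.map MvPolynomial.C)
    (fun τ j => MvPolynomial.X (τ, j)) (t k) i).det
  have hP : ∀ w : ℕ → Fin p → ℝ, MvPolynomial.eval (fun x => (w x.1 x.2 : ℂ)) P =
      (Matrix.of fun i k => modalState d b (fun τ j => (w τ j : ℂ)) (t k) i).det := by
    intro w
    rw [RingHom.map_det]
    congr 1
    ext i k
    simp only [RingHom.mapMatrix_apply, Matrix.map_apply, Matrix.of_apply, map_modalState]
    congr 1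
    · ext i; simp
    · ext i; simp
    · ext i; simp
  have hna : ∀ x : ℕ × Fin p, NullSingletonClass (μ.map fun ω => u x.1 ω x.2) := by
    intro x
    rw [(hu.law x.1 x.2).map_eq]
    exact nullSingletonClass_gaussianReal hu.variance_pos.ne'
  have h := ae_eval_ne_zero hu.indep (fun x => (hu.law x.1 x.2).aemeasurable) hna P
    (a := fun x => u₀ x.1 x.2) (by
      rw [hP u₀, ← isUnit_iff_ne_zero, ← Matrix.isUnit_iff_isUnit_det,
        ← Matrix.linearIndependent_cols_iff_isUnit]
      exact hu₀)
  filter_upwards [h] with ω hω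
  rwa [hP (fun τ j => u τ ω j)] at hω

/-! ### Spectral norm estimates -/

section OperatorNorm

variable {m n l : Type*} [Fintype m] [Fintype n] [Fintype l] [DecidableEq n] [DecidableEq l]

theorem l2_opNorm_one_le : ‖(1 : Matrix n n ℂ)‖ ≤ 1 := by
  rw [← Matrix.diagonal_one, Matrix.l2_opNorm_diagonal]
  exact (pi_norm_le_iff_of_nonneg zero_le_one).2 fun i => by simp

theorem l2_opNorm_le_one_of_conjTranspose_mul_self {L : Matrix m n ℂ} (h : ‖Lᴴ * L‖ ≤ 1) :
    ‖L‖ ≤ 1 := by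
  rw [Matrix.l2_opNorm_conjTranspose_mul_self] at h
  nlinarith [norm_nonneg L]

theorem isUnit_of_norm_one_sub_lt_one {M : Matrix n n ℂ} (h : ‖1 - M‖ < 1) : IsUnit M := by
  simpa using isUnit_one_sub_of_norm_lt_one h

theorem l2_opNorm_mul_le_of_le {A : Matrix m n ℂ} {B : Matrix n l ℂ} {a b : ℝ} (hA : ‖A‖ ≤ a)
    (hB : ‖B‖ ≤ b) : ‖A * B‖ ≤ a * b :=
  (Matrix.l2_opNorm_mul A B).trans
    (mul_le_mul hA hB (norm_nonneg _) ((norm_nonneg _).trans hA))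

end OperatorNorm

/-! ### Existence of singular value decompositions -/

section SVD

variable {n m : ℕ}

theorem cplx_mul {k : ℕ} (A : Matrix (Fin n) (Fin m) ℝ) (B : Matrix (Fin m) (Fin k) ℝ) :
    cplx (A * B) = cplx A * cplx B :=
  Matrix.map_mul (f := Complex.ofRealHom)

theorem cplx_transpose_mul_self_of_orthogonal {k : ℕ} {L : Matrix (Fin n) (Fin k) ℝ}
    (h : Lᵀ * L = 1) : (cplx L)ᴴ * cplx L = 1 := by
  have h1 : (cplx L)ᴴ = cplx Lᵀ := by
    ext i j; simp
  rw [h1, ← cplx_mul, h]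
  exact Matrix.map_one _ Complex.ofReal_zero Complex.ofReal_one

theorem norm_cplx_le_one {k : ℕ} {L : Matrix (Fin n) (Fin k) ℝ} (h : Lᵀ * L = 1) :
    ‖cplx L‖ ≤ 1 := by
  apply l2_opNorm_le_one_of_conjTranspose_mul_self
  rw [cplx_transpose_mul_self_of_orthogonal h]
  exact l2_opNorm_one_le

theorem norm_cplx_transpose_le_one {k : ℕ} {L : Matrix (Fin n) (Fin k) ℝ} (h : Lᵀ * L = 1) :
    ‖cplx Lᵀ‖ ≤ 1 := by
  have h1 : cplx Lᵀ = (cplx L)ᴴ := by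
    ext i j; simp
  rw [h1, Matrix.l2_opNorm_conjTranspose]
  exact norm_cplx_le_one h

theorem submatrix_orthogonal {l : ℕ} (hl : l ≤ n) {L : Matrix (Fin n) (Fin n) ℝ}
    (h : Lᵀ * L = 1) :
    (L.submatrix id (Fin.castLE hl))ᵀ * L.submatrix id (Fin.castLE hl) = 1 := by
  rw [Matrix.transpose_submatrix, ← Matrix.submatrix_mul _ _ _ _ _ Function.bijective_id, h,
    Matrix.submatrix_one _ (Fin.castLE_injective hl)]

/-- The right singular vectors are an eigenbasis of `T* T`. Their images are orthogonal; those with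
positive singular value are normalized and extended to an orthonormal basis. -/
theorem exists_isSVD (H : Matrix (Fin n) (Fin m) ℝ) : ∃ L s R, IsSVD H L s R := by
  classical
  set T := Matrix.toEuclideanLin H with hTdef
  have hm : Module.finrank ℝ (EuclideanSpace ℝ (Fin m)) = m := by simp
  set r := T.isSymmetric_adjoint_comp_self.eigenvectorBasis hm with hr
  set s : ℕ → ℝ := ⇑T.singularValues with hs
  have hinner : ∀ i j, inner ℝ (T (r i)) (T (r j)) = if i = j then s j ^ 2 else 0 := by
    intro i j
    have h1 : (LinearMap.adjoint T ∘ₗ T) (r j) = (s j ^ 2) • r j := by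
      rw [hs, T.sq_singularValues_fin hm]
      exact T.isSymmetric_adjoint_comp_self.apply_eigenvectorBasis hm j
    rw [← LinearMap.adjoint_inner_right]
    change inner ℝ (r i) ((LinearMap.adjoint T ∘ₗ T) (r j)) = _
    rw [h1, inner_smul_right, orthonormal_iff_ite.1 r.orthonormal i j]
    split_ifs <;> simp
  let v : Fin n → EuclideanSpace ℝ (Fin n) := fun i =>
    if h : (i : ℕ) < m then (s i)⁻¹ • T (r ⟨i, h⟩) else 0
  have hpos : ∀ k, 0 < s k → k < m ∧ k < n := by
    intro k hk
    have h1 := T.singularValues_pos_iff_lt_finrank_range.1 hk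
    have h2 := LinearMap.finrank_range_le T
    have h3 := Submodule.finrank_le (LinearMap.range T)
    simp only [finrank_euclideanSpace_fin] at h2 h3
    omega
  have hv : Orthonormal ℝ (Set.domRestrict {i : Fin n | 0 < s i} v) := by
    rw [orthonormal_iff_ite]
    rintro ⟨i, hi⟩ ⟨j, hj⟩
    have hi' : 0 < s i := hi
    have hj' : 0 < s j := hj
    simp only [Set.domRestrict_apply, v, dif_pos (hpos _ hi').1, dif_pos (hpos _ hj').1,
      inner_smul_left, inner_smul_right, hinner, Subtype.mk.injEq, Fin.mk.injEq, Fin.val_inj]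
    split_ifs with h
    · subst h
      simp; field_simp
    · simp
  obtain ⟨b, hb⟩ := hv.exists_orthonormalBasis_extension_of_card_eq (by simp)
  have hTr : ∀ j : Fin m, T (r j) = if h : (j : ℕ) < n then s j • b ⟨j, h⟩ else 0 := by
    intro j
    rcases (T.singularValues_nonneg j).eq_or_lt with h0 | h0
    · have h1 : T (r j) = 0 := by
        have := hinner j j
        rw [if_pos rfl, hs, ← h0] at this
        simpa using this
      rw [h1, hs, ← h0]
      simp
    · have h1 := hpos _ h0
      rw [dif_pos h1.2, hb ⟨j, h1.2⟩ h0]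
      simp only [v, dif_pos h1.1, smul_smul]
      rw [mul_inv_cancel₀ h0.ne', one_smul]
  have hR : (Matrix.of fun a j => r j a)ᵀ * (Matrix.of fun a j => r j a) = 1 := by
    ext i j
    have := orthonormal_iff_ite.1 r.orthonormal j i
    simpa [Matrix.mul_apply, PiLp.inner_apply, Matrix.one_apply, eq_comm] using this
  refine ⟨Matrix.of fun a i => b i a, s, Matrix.of fun a j => r j a, ?_, hR,
    T.singularValues_antitone, T.singularValues_nonneg, ?_⟩
  · ext i j
    have := orthonormal_iff_ite.1 b.orthonormal j i
    simpa [Matrix.mul_apply, PiLp.inner_apply, Matrix.one_apply, eq_comm] using this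
  · have hHR : H * (Matrix.of fun a j => r j a) = (Matrix.of fun a i => b i a) *
        (Matrix.of fun (i : Fin n) (j : Fin m) => if (i : ℕ) = j then s i else 0) := by
      ext a j
      have h1 : (H * (Matrix.of fun a j => r j a)) a j = T (r j) a := rfl
      rw [h1, hTr, Matrix.mul_apply]
      simp only [Matrix.of_apply]
      split_ifs with h
      · rw [Finset.sum_eq_single ⟨j, h⟩]
        · simp [mul_comm]
        · intro i _ hi
          rw [if_neg (fun h' => hi (Fin.ext h')), mul_zero]
        · simp
      · symm
        apply Finset.sum_eq_zero
        intro i _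
        rw [if_neg (by have := i.2; omega), mul_zero]
    rw [← hHR, Matrix.mul_assoc, mul_eq_one_comm.1 hR, Matrix.mul_one]

end SVD

/-! ### Lower bound for singular values -/

section SingularValueBound

variable {n m l : ℕ}

/-- Keeping only the first `k` singular values of `H` turns `G H F` into an `l × l` matrix of rank
at most `k < l`. It is singular, hence at distance at least 1 from the identity, and the discarded
part has norm at most `‖G‖ * s k * ‖F‖`. -/
theorem one_le_norm_one_sub_add_singularValue {H : Matrix (Fin n) (Fin m) ℝ}
    {L : Matrix (Fin n) (Fin n) ℝ} {s : ℕ → ℝ} {R : Matrix (Fin m) (Fin m) ℝ}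
    (h : IsSVD H L s R) (G : Matrix (Fin l) (Fin n) ℂ) (F : Matrix (Fin m) (Fin l) ℂ) {k : ℕ}
    (hk : k < l) : 1 ≤ ‖1 - G * cplx H * F‖ + ‖G‖ * s k * ‖F‖ := by
  let J : Matrix (Fin n) (Fin m) ℂ := Matrix.of fun i j => if (i : ℕ) = j then 1 else 0
  let d₁ : Fin n → ℂ := fun i => if (i : ℕ) < k then (s i : ℂ) else 0
  let d₂ : Fin n → ℂ := fun i => if (i : ℕ) < k then 0 else (s i : ℂ)
  have hJ : ‖J‖ ≤ 1 := by
    apply l2_opNorm_le_one_of_conjTranspose_mul_self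
    have : Jᴴ * J = Matrix.diagonal fun j : Fin m => if (j : ℕ) < n then (1 : ℂ) else 0 := by
      ext i j
      simp only [Matrix.mul_apply, Matrix.conjTranspose_apply, J, Matrix.of_apply,
        Matrix.diagonal_apply]
      by_cases hi : (i : ℕ) < n
      · rw [Finset.sum_eq_single ⟨i, hi⟩]
        · simp [hi, Fin.ext_iff]
        · intro a _ ha
          rw [if_neg (fun h' => ha (Fin.ext h'))]
          simp
        · simp
      · rw [Finset.sum_eq_zero]
        · simp [hi]
        · intro a _
          rw [if_neg (by have := a.2; omega)]
          simp
    rw [this, Matrix.l2_opNorm_diagonal]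
    refine (pi_norm_le_iff_of_nonneg zero_le_one).2 fun i => ?_
    split_ifs <;> simp
  have hd₂ : ‖Matrix.diagonal d₂‖ ≤ s k := by
    rw [Matrix.l2_opNorm_diagonal]
    refine (pi_norm_le_iff_of_nonneg (h.nonneg k)).2 fun i => ?_
    simp only [d₂]
    split_ifs with hi
    · simpa using h.nonneg k
    · rw [Complex.norm_real, Real.norm_of_nonneg (h.nonneg _)]
      exact h.antitone (by omega)
  have hH : cplx H = cplx L * (Matrix.diagonal d₁ * J + Matrix.diagonal d₂ * J) * cplx Rᵀ := by
    conv_lhs => rw [h.eq]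
    rw [cplx_mul, cplx_mul, ← Matrix.add_mul, Matrix.diagonal_add]
    congr 2
    ext i j
    simp only [Matrix.map_apply, Matrix.of_apply, Matrix.diagonal_mul, J, d₁, d₂]
    split_ifs <;> simp
  by_contra! hlt
  set M₁ := G * cplx L * Matrix.diagonal d₁ * (J * cplx Rᵀ * F) with hM₁
  set M₂ := G * (cplx L * Matrix.diagonal d₂ * J * cplx Rᵀ) * F with hM₂
  have hsum : 1 - M₁ = (1 - G * cplx H * F) + M₂ := by
    rw [hH, hM₁, hM₂]
    simp only [Matrix.mul_add, Matrix.add_mul, Matrix.mul_assoc]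
    abel
  have hnM₂ : ‖M₂‖ ≤ ‖G‖ * s k * ‖F‖ := by
    refine l2_opNorm_mul_le_of_le (l2_opNorm_mul_le_of_le le_rfl ?_) le_rfl
    have h1 := l2_opNorm_mul_le_of_le (l2_opNorm_mul_le_of_le (l2_opNorm_mul_le_of_le
      (norm_cplx_le_one h.left_orthogonal) hd₂) hJ) (norm_cplx_transpose_le_one h.right_orthogonal)
    simpa using h1
  have hunit : IsUnit M₁ := by
    apply isUnit_of_norm_one_sub_lt_one
    rw [hsum]
    exact (norm_add_le _ _).trans_lt (by linarith)
  have hr := Matrix.rank_of_isUnit M₁ hunit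
  have hr1 : M₁.rank ≤ (Matrix.diagonal d₁).rank :=
    (Matrix.rank_mul_le_left _ _).trans (Matrix.rank_mul_le_right _ _)
  rw [Matrix.rank_diagonal] at hr1
  have hcard : Fintype.card {i // d₁ i ≠ 0} ≤ Fintype.card (Fin k) := by
    have hlt : ∀ i : {i // d₁ i ≠ 0}, ((i : Fin n) : ℕ) < k := by
      rintro ⟨i, hi⟩
      by_contra hik
      exact hi (if_neg hik)
    refine Fintype.card_le_of_injective (fun i => (⟨i, hlt i⟩ : Fin k)) fun i j hij => ?_
    simpa [Fin.ext_iff, Subtype.ext_iff] using hij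
  simp only [Fintype.card_fin] at hr hcard
  omega

end SingularValueBound

/-! ### Diagonalizability near a simple spectrum -/

theorem Multiset.pow_card_le_prod_map_norm (S : Multiset ℂ) {η : ℝ} (hη : 0 ≤ η)
    (h : ∀ x ∈ S, η ≤ ‖x‖) : η ^ S.card ≤ ‖S.prod‖ := by
  induction S using Multiset.induction_on with
  | empty => simp
  | cons a S ih =>
    rw [Multiset.card_cons, Multiset.prod_cons, norm_mul, pow_succ']
    exact mul_le_mul (h a (Multiset.mem_cons_self a S))
      (ih fun x hx => h x (Multiset.mem_cons_of_mem hx)) (by positivity) (norm_nonneg _)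

/-- Matrices close to a diagonal matrix with distinct entries are diagonalizable. -/
theorem exists_forall_diagonalizable {l : ℕ} {d : Fin l → ℂ} (hd : Function.Injective d) :
    ∃ δ > 0, ∀ M : Matrix (Fin l) (Fin l) ℂ, ‖M - Matrix.diagonal d‖ < δ →
      ∃ (P : Matrix (Fin l) (Fin l) ℂ) (μ : Fin l → ℂ),
        IsUnit P ∧ M = P * Matrix.diagonal μ * P⁻¹ := by
  obtain ⟨η, hη, hsep⟩ : ∃ η > 0, ∀ i j, i ≠ j → 2 * η ≤ ‖d i - d j‖ := by
    have h1 : ∀ x : Fin l × Fin l, ∃ η > 0, x.1 ≠ x.2 → 2 * η ≤ ‖d x.1 - d x.2‖ := by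
      intro x
      by_cases hx : x.1 = x.2
      · exact ⟨1, one_pos, fun h => absurd hx h⟩
      · refine ⟨‖d x.1 - d x.2‖ / 2, half_pos (norm_pos_iff.2 (sub_ne_zero.2 (hd.ne hx))), ?_⟩
        intro _
        linarith
    choose η hη hsep using h1
    rcases isEmpty_or_nonempty (Fin l × Fin l) with he | he
    · exact ⟨1, one_pos, fun i j => (he.false (i, j)).elim⟩
    · refine ⟨Finset.univ.inf' Finset.univ_nonempty η, ?_, fun i j hij => ?_⟩
      · rw [gt_iff_lt, Finset.lt_inf'_iff]
        exact fun x _ => hη x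
      · refine le_trans ?_ (hsep (i, j) hij)
        have := Finset.inf'_le η (Finset.mem_univ (i, j))
        linarith
  -- The determinant is the product of the `l` differences between `d j` and the eigenvalues of `M`.
  -- A value below `η ^ l` forces an eigenvalue within `η` of `d j`, and the gap `2 * η` keeps these
  -- eigenvalues distinct.
  have hev : ∀ᶠ M in nhds (Matrix.diagonal d), ∀ j,
      ‖(Matrix.scalar (Fin l) (d j) - M).det‖ < η ^ l := by
    rw [Filter.eventually_all]
    intro j
    have hcont : Continuous fun M : Matrix (Fin l) (Fin l) ℂ =>
        ‖(Matrix.scalar (Fin l) (d j) - M).det‖ :=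
      (Continuous.matrix_det (continuous_const.sub continuous_id)).norm
    refine hcont.continuousAt.eventually_lt continuousAt_const ?_
    have : (Matrix.scalar (Fin l) (d j) - Matrix.diagonal d).det = 0 := by
      rw [Matrix.scalar_apply, Matrix.diagonal_sub, Matrix.det_diagonal]
      exact Finset.prod_eq_zero (Finset.mem_univ j) (by simp)
    rw [this, norm_zero]
    positivity
  obtain ⟨δ, hδ, hball⟩ := Metric.eventually_nhds_iff.1 hev
  refine ⟨δ, hδ, fun M hM => ?_⟩
  have hdet := hball (y := M) (by rwa [dist_eq_norm])
  have hroot : ∀ j, ∃ μ ∈ M.charpoly.roots, ‖d j - μ‖ < η := by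
    intro j
    by_contra! hall
    have hsplit := IsAlgClosed.splits M.charpoly
    have h1 := hsplit.eval_eq_prod_roots_of_monic M.charpoly_monic (d j)
    rw [Matrix.eval_charpoly] at h1
    have h2 := Multiset.pow_card_le_prod_map_norm (M.charpoly.roots.map (d j - ·)) hη.le (by
      intro x hx
      obtain ⟨μ, hμ, rfl⟩ := Multiset.mem_map.1 hx
      exact hall μ hμ)
    rw [← h1, Multiset.card_map, ← hsplit.natDegree_eq_card_roots,
      Matrix.charpoly_natDegree_eq_dim, Fintype.card_fin] at h2
    exact absurd (hdet j) (not_lt.2 h2)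
  choose μ hμ hclose using hroot
  have hinj : Function.Injective μ := by
    intro i j hij
    by_contra hne
    have h1 := hsep i j hne
    have h2 : d i - d j = (d i - μ i) - (d j - μ j) := by rw [hij]; ring
    have h3 := norm_sub_le (d i - μ i) (d j - μ j)
    rw [← h2] at h3
    linarith [hclose i, hclose j]
  have hvec : ∀ j, ∃ v : Fin l → ℂ, v ≠ 0 ∧ M *ᵥ v = μ j • v := by
    intro j
    have h1 := (Polynomial.mem_roots'.1 (hμ j)).2
    rw [Polynomial.IsRoot, Matrix.eval_charpoly] at h1
    obtain ⟨v, hv, hv'⟩ := Matrix.exists_mulVec_eq_zero_iff.2 h1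
    refine ⟨v, hv, ?_⟩
    rw [Matrix.sub_mulVec, sub_eq_zero] at hv'
    rw [← hv', Matrix.scalar_apply]
    ext i
    simp [Matrix.mulVec_diagonal]
  choose v hv hMv using hvec
  have hli : LinearIndependent ℂ v :=
    Module.End.eigenvectors_linearIndependent' (Matrix.toLin' M) μ hinj v fun j =>
      ⟨Module.End.mem_eigenspace_iff.2 (by simpa using hMv j), hv j⟩
  have hP : IsUnit (Matrix.of fun i j => v j i) := by
    rw [← Matrix.linearIndependent_cols_iff_isUnit]
    exact hli
  refine ⟨Matrix.of fun i j => v j i, μ, hP, ?_⟩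
  have hMP : M * (Matrix.of fun i j => v j i) =
      (Matrix.of fun i j => v j i) * Matrix.diagonal μ := by
    ext i j
    have := congrFun (hMv j) i
    rw [Matrix.mul_diagonal]
    simpa [Matrix.mul_apply, Matrix.mulVec, dotProduct, mul_comm] using this
  rw [← hMP, Matrix.mul_assoc, Matrix.mul_nonsing_inv _ ((Matrix.isUnit_iff_isUnit_det _).1 hP),
    Matrix.mul_one]

/-! ### Perturbation of the reduced model -/

section Perturbation

variable {l m n p q : ℕ}

/-- The error obeys `e_{i+1} ≤ ρ e_i + δ`, whose fixed point is `δ / (1 - ρ)`. Contractivity is what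
makes the bound independent of `i`. -/
theorem norm_pow_sub_pow_le {M D : Matrix (Fin l) (Fin l) ℂ} {δ ρ : ℝ} (hδ : ‖M - D‖ ≤ δ)
    (hM : ‖M‖ ≤ ρ) (hD : ‖D‖ ≤ ρ) (hρ : ρ < 1) (i : ℕ) :
    ‖M ^ i - D ^ i‖ ≤ δ / (1 - ρ) ∧ ‖M ^ i‖ ≤ 1 ∧ ‖D ^ i‖ ≤ 1 := by
  have hρ0 : 0 ≤ ρ := (norm_nonneg _).trans hM
  have hδ0 : 0 ≤ δ := (norm_nonneg _).trans hδ
  have h1ρ : 0 < 1 - ρ := by linarith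
  induction i with
  | zero => simpa using ⟨by positivity, l2_opNorm_one_le⟩
  | succ i ih =>
    obtain ⟨h1, h2, h3⟩ := ih
    refine ⟨?_, ?_, ?_⟩
    · have : M ^ (i + 1) - D ^ (i + 1) = M * (M ^ i - D ^ i) + (M - D) * D ^ i := by
        rw [pow_succ', pow_succ', mul_sub, sub_mul]; abel
      rw [this]
      refine (norm_add_le_of_le (l2_opNorm_mul_le_of_le hM h1)
        (l2_opNorm_mul_le_of_le hδ h3)).trans (le_of_eq ?_)
      field_simp
      ring
    · rw [pow_succ']
      exact (l2_opNorm_mul_le_of_le hM h2).trans (by linarith)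
    · rw [pow_succ']
      exact (l2_opNorm_mul_le_of_le hD h3).trans (by linarith)

/-- Near a factorization `H ≈ Z X` through `ℂ^l`, matrices `E'`, `E` with `E' H E = 1` yield
an approximate similarity between the reduced dynamics `E' HA E` and the dynamics `D` on `ℂ^l`. -/
theorem exists_approximate_similarity {β η : ℝ} (hη : β ^ 2 * η ≤ 1 / 2)
    {X : Matrix (Fin l) (Fin m) ℂ} {Z : Matrix (Fin n) (Fin l) ℂ} {D : Matrix (Fin l) (Fin l) ℂ}
    {E : Matrix (Fin m) (Fin l) ℂ} {E' : Matrix (Fin l) (Fin n) ℂ}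
    {H HA : Matrix (Fin n) (Fin m) ℂ} (hX : ‖X‖ ≤ β) (hZ : ‖Z‖ ≤ β) (hD : ‖D‖ ≤ 1)
    (hE : ‖E‖ ≤ β) (hE' : ‖E'‖ ≤ β) (hone : E' * H * E = 1) (hH : ‖H - Z * X‖ ≤ η)
    (hHA : ‖HA - Z * D * X‖ ≤ η) :
    ∃ J : Matrix (Fin l) (Fin l) ℂ, X * E * J = 1 ∧ J * (X * E) = 1 ∧ ‖J‖ ≤ 2 * β ^ 2 ∧
      ‖X * E * (E' * Z) - 1‖ ≤ 2 * β ^ 6 * η ∧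
      ‖X * E * (E' * HA * E) * J - D‖ ≤ 4 * β ^ 6 * η := by
  have hη0 : 0 ≤ η := (norm_nonneg _).trans hH
  set T := X * E with hT
  set S := E' * Z with hS
  have hTn : ‖T‖ ≤ β ^ 2 := by
    rw [sq]; exact l2_opNorm_mul_le_of_le hX hE
  have hSn : ‖S‖ ≤ β ^ 2 := by
    rw [sq]; exact l2_opNorm_mul_le_of_le hE' hZ
  have hST : ‖1 - S * T‖ ≤ β ^ 2 * η := by
    have : 1 - S * T = E' * (H - Z * X) * E := by
      rw [Matrix.mul_sub, Matrix.sub_mul, hone, hS, hT]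
      simp only [Matrix.mul_assoc]
    rw [this]
    exact (l2_opNorm_mul_le_of_le (l2_opNorm_mul_le_of_le hE' hH) hE).trans (by nlinarith)
  have hunit : IsUnit (S * T) := isUnit_of_norm_one_sub_lt_one (by linarith)
  have hTunit : IsUnit T := by
    rw [Matrix.isUnit_iff_isUnit_det] at hunit ⊢
    rw [Matrix.det_mul] at hunit
    exact isUnit_of_mul_isUnit_right hunit
  have hTJ : T * T⁻¹ = 1 := Matrix.mul_nonsing_inv _ ((Matrix.isUnit_iff_isUnit_det _).1 hTunit)
  have hJT : T⁻¹ * T = 1 := Matrix.nonsing_inv_mul _ ((Matrix.isUnit_iff_isUnit_det _).1 hTunit)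
  have hJn : ‖T⁻¹‖ ≤ 2 * β ^ 2 := by
    -- As `‖1 - S * T‖ ≤ 1 / 2`, the second term is absorbed into the left-hand side.
    have h1 : T⁻¹ = S + (1 - S * T) * T⁻¹ := by
      rw [sub_mul, one_mul, mul_assoc, hTJ, mul_one]; abel
    have h2 : ‖T⁻¹‖ ≤ β ^ 2 + 1 / 2 * ‖T⁻¹‖ := by
      conv_lhs => rw [h1]
      exact norm_add_le_of_le hSn (l2_opNorm_mul_le_of_le (hST.trans hη) le_rfl)
    linarith
  have hTS : ‖T * S - 1‖ ≤ 2 * β ^ 6 * η := by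
    -- `T * S - 1` is conjugate to `S * T - 1` by `T`.
    have h1 : T * S - 1 = - (T * (1 - S * T) * T⁻¹) := by
      rw [mul_sub, sub_mul, mul_one, hTJ, ← mul_assoc, mul_assoc (T * S), hTJ, mul_one]; abel
    rw [h1, norm_neg]
    exact (l2_opNorm_mul_le_of_le (l2_opNorm_mul_le_of_le hTn hST) hJn).trans
      (le_of_eq (by ring))
  refine ⟨T⁻¹, hTJ, hJT, hJn, hTS, ?_⟩
  have h1 : T * (E' * HA * E) * T⁻¹ - D =
      T * (E' * (HA - Z * D * X) * E) * T⁻¹ + (T * S - 1) * D := by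
    have h2 : T * (E' * (Z * D * X) * E) * T⁻¹ = T * S * D := by
      calc T * (E' * (Z * D * X) * E) * T⁻¹ = T * S * D * (T * T⁻¹) := by
            rw [hS, hT]; simp only [Matrix.mul_assoc]
        _ = T * S * D := by rw [hTJ, mul_one]
    rw [Matrix.mul_sub, Matrix.sub_mul, Matrix.mul_sub, Matrix.sub_mul, h2, sub_mul, one_mul]
    abel
  rw [h1]
  refine (norm_add_le_of_le (l2_opNorm_mul_le_of_le (l2_opNorm_mul_le_of_le hTn
    (l2_opNorm_mul_le_of_le (l2_opNorm_mul_le_of_le hE' hHA) hE)) hJn)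
    (l2_opNorm_mul_le_of_le hTS hD)).trans (le_of_eq (by ring))

/-- The Markov parameters of the reduced model are Lipschitz in the error `η` of the data. -/
theorem norm_reduced_markov_sub_le {β ρ η : ℝ} (hβ : 1 ≤ β) (hρ : ρ < 1)
    (hη : β ^ 2 * η ≤ 1 / 2) (hηρ : 4 * β ^ 6 * η ≤ (1 - ρ) / 2)
    {X : Matrix (Fin l) (Fin m) ℂ} {Z : Matrix (Fin n) (Fin l) ℂ} {D : Matrix (Fin l) (Fin l) ℂ}
    {B : Matrix (Fin l) (Fin p) ℂ} {C : Matrix (Fin q) (Fin l) ℂ}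
    {E : Matrix (Fin m) (Fin l) ℂ} {E' : Matrix (Fin l) (Fin n) ℂ}
    {H HA : Matrix (Fin n) (Fin m) ℂ} {HB : Matrix (Fin n) (Fin p) ℂ}
    {HC : Matrix (Fin q) (Fin m) ℂ} (hX : ‖X‖ ≤ β) (hZ : ‖Z‖ ≤ β) (hD : ‖D‖ ≤ ρ)
    (hB : ‖B‖ ≤ β) (hC : ‖C‖ ≤ β)
    (hE : ‖E‖ ≤ β) (hE' : ‖E'‖ ≤ β) (hone : E' * H * E = 1) (hH : ‖H - Z * X‖ ≤ η)
    (hHA : ‖HA - Z * D * X‖ ≤ η) (hHB : ‖HB - Z * B‖ ≤ η) (hHC : ‖HC - C * X‖ ≤ η) (i : ℕ) :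
    ‖HC * E * (E' * HA * E) ^ i * (E' * HB) - C * D ^ i * B‖ ≤
      (6 * β ^ 8 + 24 * β ^ 12 / (1 - ρ) + 3 * β ^ 8) * η := by
  obtain ⟨J, hTJ, hJT, hJn, hTS, hM⟩ :=
    exists_approximate_similarity hη hX hZ (hD.trans hρ.le) hE hE' hone hH hHA
  have hη0 : 0 ≤ η := (norm_nonneg _).trans hH
  have h1ρ : 0 < 1 - ρ := by linarith
  set T := X * E with hT
  set M := T * (E' * HA * E) * J with hMdef
  have hTn : ‖T‖ ≤ β ^ 2 := by
    rw [sq]; exact l2_opNorm_mul_le_of_le hX hE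
  -- The perturbation uses up at most half of the stability margin `1 - ρ`.
  have hMn : ‖M‖ ≤ (1 + ρ) / 2 := by
    have : ‖M‖ ≤ ‖M - D‖ + ‖D‖ := by simpa using norm_add_le (M - D) D
    linarith
  obtain ⟨hp, hMi, hDi⟩ := norm_pow_sub_pow_le hM hMn (hD.trans (by linarith)) (by linarith) i
  have hpow : (E' * HA * E) ^ i = J * M ^ i * T := by
    clear hp hMi hDi
    induction i with
    | zero => simp [hJT]
    | succ i ih =>
      rw [pow_succ', ih, pow_succ', hMdef]
      calc E' * HA * E * (J * (T * (E' * HA * E) * J) ^ i * T)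
          = (J * T) * (E' * HA * E) * (J * (T * (E' * HA * E) * J) ^ i * T) := by
            rw [hJT, one_mul]
        _ = _ := by simp only [Matrix.mul_assoc]
  have hCn : ‖HC * E * J - C‖ ≤ 2 * β ^ 3 * η := by
    have : HC * E * J - C = (HC - C * X) * E * J := by
      rw [Matrix.sub_mul, Matrix.sub_mul, Matrix.mul_assoc C, ← hT, Matrix.mul_assoc C, hTJ,
        Matrix.mul_one]
    rw [this]
    exact (l2_opNorm_mul_le_of_le (l2_opNorm_mul_le_of_le hHC hE) hJn).trans
      (le_of_eq (by ring))
  have hβ37 : β ^ 3 * η ≤ β ^ 7 * η :=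
    mul_le_mul_of_nonneg_right (pow_le_pow_right₀ hβ (by norm_num)) hη0
  have hBn : ‖T * (E' * HB) - B‖ ≤ 3 * β ^ 7 * η := by
    have : T * (E' * HB) - B = T * (E' * (HB - Z * B)) + (T * (E' * Z) - 1) * B := by
      rw [Matrix.mul_sub, Matrix.mul_sub, Matrix.sub_mul, Matrix.one_mul]
      simp only [Matrix.mul_assoc]
      abel
    rw [this]
    refine (norm_add_le_of_le (l2_opNorm_mul_le_of_le hTn (l2_opNorm_mul_le_of_le hE' hHB))
      (l2_opNorm_mul_le_of_le hTS hB)).trans ?_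
    linarith
  have hBn' : ‖T * (E' * HB)‖ ≤ 3 * β ^ 5 := by
    have h1 : ‖T * (E' * HB)‖ ≤ ‖T * (E' * HB) - B‖ + ‖B‖ := by
      simpa using norm_add_le (T * (E' * HB) - B) B
    have h2 : 3 * β ^ 7 * η ≤ 3 / 2 * β ^ 5 := by
      have := mul_le_mul_of_nonneg_left hη (by positivity : 0 ≤ 3 * β ^ 5)
      linarith
    have h3 : β ≤ β ^ 5 := le_self_pow₀ hβ (by norm_num)
    linarith
  -- The errors in output, dynamics and input are separated; they yield the three summands of the
  -- constant in this order.
  have hsplit : HC * E * (E' * HA * E) ^ i * (E' * HB) - C * D ^ i * B =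
      (HC * E * J - C) * M ^ i * (T * (E' * HB)) + C * (M ^ i - D ^ i) * (T * (E' * HB)) +
        C * D ^ i * (T * (E' * HB) - B) := by
    rw [hpow]
    simp only [Matrix.sub_mul, Matrix.mul_sub, Matrix.mul_assoc]
    abel
  rw [hsplit]
  refine (norm_add_le_of_le (norm_add_le_of_le
    (l2_opNorm_mul_le_of_le (l2_opNorm_mul_le_of_le hCn hMi) hBn')
    (l2_opNorm_mul_le_of_le (l2_opNorm_mul_le_of_le hC hp) hBn'))
    (l2_opNorm_mul_le_of_le (l2_opNorm_mul_le_of_le hC hDi) hBn)).trans (le_of_eq ?_)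
  have : 1 - (1 + ρ) / 2 = (1 - ρ) / 2 := by ring
  rw [this]
  field_simp
  ring

end Perturbation

/-! ### Modal coordinates -/

section Modal

theorem cplx_transpose {m n : ℕ} (M : Matrix (Fin m) (Fin n) ℝ) : cplx Mᵀ = (cplx M)ᵀ := rfl

variable {N p q l : ℕ} {A : Matrix (Fin N) (Fin N) ℝ} {V U : Matrix (Fin N) (Fin N) ℂ}
  {lam : Fin N → ℂ}

/-- Duality: the adjoint system exchanges `U` and `V`, so the results on controllability and `X`
also cover observability and `Z`. -/
theorem IsEigendecomposition.transpose (h : IsEigendecomposition A V lam U) :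
    IsEigendecomposition Aᵀ U lam V where
  eq := by
    rw [cplx_transpose, h.eq, Matrix.transpose_mul, Matrix.transpose_mul,
      Matrix.transpose_transpose, Matrix.diagonal_transpose, Matrix.mul_assoc]
  biorthogonal := by
    rw [← Matrix.transpose_transpose U, ← Matrix.transpose_mul, h.biorthogonal,
      Matrix.transpose_one]

theorem IsEigendecomposition.mul_transpose_eq_one (h : IsEigendecomposition A V lam U) :
    V * Uᵀ = 1 :=
  mul_eq_one_comm.1 h.biorthogonal

theorem IsEigendecomposition.transpose_mul (h : IsEigendecomposition A V lam U) :
    Uᵀ * cplx A = Matrix.diagonal lam * Uᵀ := by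
  rw [h.eq, ← Matrix.mul_assoc, ← Matrix.mul_assoc, h.biorthogonal, Matrix.one_mul]

theorem IsEigendecomposition.pow_eq (h : IsEigendecomposition A V lam U) (i : ℕ) :
    cplx A ^ i = V * Matrix.diagonal lam ^ i * Uᵀ := by
  induction i with
  | zero => simp [h.mul_transpose_eq_one]
  | succ i ih =>
    rw [pow_succ, ih, Matrix.mul_assoc, h.transpose_mul, pow_succ]
    simp only [Matrix.mul_assoc]

theorem IsEigendecomposition.norm_lt_one (h : IsEigendecomposition A V lam U)
    (hA : IsStableMatrix A) : ‖lam‖ < 1 := by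
  rw [pi_norm_lt_iff one_pos]
  intro i
  apply hA
  let u : (Matrix (Fin N) (Fin N) ℂ)ˣ := ⟨V, Uᵀ, h.mul_transpose_eq_one, h.biorthogonal⟩
  have h1 : cplx A = u * Matrix.diagonal lam * (u⁻¹ : (Matrix (Fin N) (Fin N) ℂ)ˣ) := h.eq
  rw [h1, spectrum.units_conjugate, spectrum_diagonal]
  exact ⟨i, rfl⟩

theorem NearlyUncontrollable.exists_eq_add_smul {c : Finset (Fin N)}
    {B : ℝ → Matrix (Fin N) (Fin p) ℝ} (h : NearlyUncontrollable U c B) :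
    ∃ b₀ b₁ : Matrix (Fin N) (Fin p) ℂ, (∀ i ∉ c, ∀ j, b₀ i j = 0) ∧
      (∀ i ∈ c, ∀ j, b₀ i j = (Uᵀ * cplx (B 0)) i j) ∧
      ∀ ε : ℝ, Uᵀ * cplx (B ε) = b₀ + (ε : ℂ) • b₁ := by
  classical
  obtain ⟨K, hK⟩ := h.small
  refine ⟨Matrix.of fun i j => if i ∈ c then (Uᵀ * cplx (B 0)) i j else 0,
    Matrix.of fun i j => if i ∈ c then 0 else K i j, ?_, ?_, ?_⟩
  · intro i hi j; simp [hi]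
  · intro i hi j; simp [hi]
  · intro ε
    ext i j
    by_cases hi : i ∈ c
    · rw [h.const ε i hi j]; simp [hi]
    · rw [hK ε i hi j]; simp [hi]

theorem NearlyUnobservable.transpose {o : Finset (Fin N)} {C : ℝ → Matrix (Fin q) (Fin N) ℝ}
    (h : NearlyUnobservable V o C) : NearlyUncontrollable V o fun ε => (C ε)ᵀ := by
  have hC : ∀ ε i j, (Vᵀ * cplx (C ε)ᵀ) i j = (cplx (C ε) * V) j i := by
    intro ε i j
    rw [cplx_transpose, ← Matrix.transpose_mul, Matrix.transpose_apply]
  obtain ⟨K, hK⟩ := h.small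
  exact ⟨⟨Kᵀ, fun ε i hi j => by rw [hC, hK ε i hi j, Matrix.transpose_apply]⟩,
    fun ε i hi j => by rw [hC, hC, h.const ε i hi j]⟩

theorem ObservableModes.transpose {s : Finset (Fin N)} {C : Matrix (Fin q) (Fin N) ℝ}
    (h : ObservableModes A C V s) : ControllableModes Aᵀ Cᵀ V s := by
  intro w hw hw0 hz
  rw [cplx_transpose, Matrix.vecMul_transpose] at *
  exact h w hw hw0 hz

theorem trajectory_modal (h : IsEigendecomposition A V lam U) (B : Matrix (Fin N) (Fin p) ℝ)
    (u : ℕ → Fin p → ℝ) (k : ℕ) : Uᵀ *ᵥ (fun i => (trajectory A B u k i : ℂ)) =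
      modalState lam (Uᵀ * cplx B) (fun τ j => (u τ j : ℂ)) k := by
  induction k with
  | zero => ext i; simp [trajectory, modalState, Matrix.mulVec, dotProduct]
  | succ k ih =>
    have h1 : (fun i => (trajectory A B u (k + 1) i : ℂ)) =
        cplx A *ᵥ (fun i => (trajectory A B u k i : ℂ)) +
          cplx B *ᵥ (fun j => (u (k + 1) j : ℂ)) := by
      ext i
      simp [trajectory, Matrix.mulVec, dotProduct]
    rw [h1, Matrix.mulVec_add, Matrix.mulVec_mulVec, h.transpose_mul, ← Matrix.mulVec_mulVec, ih,
      Matrix.mulVec_mulVec, modalState]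
    congr 1
    ext i
    simp [Matrix.mulVec_diagonal]

theorem modalState_add_smul (d : Fin N → ℂ) (b₀ b₁ : Matrix (Fin N) (Fin p) ℂ) (ε : ℂ)
    (u : ℕ → Fin p → ℂ) (k : ℕ) :
    modalState d (b₀ + ε • b₁) u k = modalState d b₀ u k + ε • modalState d b₁ u k := by
  induction k with
  | zero => simp [modalState]
  | succ k ih =>
    simp only [modalState, ih, Matrix.add_mulVec, Matrix.smul_mulVec, mul_add, smul_add,
      mul_smul_comm]
    abel

theorem modalState_comp (d : Fin N → ℂ) (b : Matrix (Fin N) (Fin p) ℂ) (e : Fin l → Fin N)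
    (u : ℕ → Fin p → ℂ) (k : ℕ) (i : Fin l) :
    modalState d b u k (e i) = modalState (d ∘ e) (b.submatrix e id) u k i := by
  induction k with
  | zero => rfl
  | succ k ih => simp [modalState, ih, Matrix.mulVec, dotProduct]

theorem modalState_eq_zero (d : Fin N → ℂ) {b : Matrix (Fin N) (Fin p) ℂ} {i : Fin N}
    (hb : ∀ j, b i j = 0) (u : ℕ → Fin p → ℂ) (k : ℕ) : modalState d b u k i = 0 := by
  induction k with
  | zero => rfl
  | succ k ih => simp [modalState, ih, Matrix.mulVec, dotProduct, hb]

theorem snapshots_modal {m : ℕ} (h : IsEigendecomposition A V lam U)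
    {B : Matrix (Fin N) (Fin p) ℝ} {b₀ b₁ : Matrix (Fin N) (Fin p) ℂ} {ε : ℂ}
    (hB : Uᵀ * cplx B = b₀ + ε • b₁) (u : ℕ → Fin p → ℝ) (t : Fin m → ℕ) :
    Uᵀ * cplx (snapshots A B u t) =
      (Matrix.of fun i k => modalState lam b₀ (fun τ j => (u τ j : ℂ)) (t k) i) +
        ε • Matrix.of fun i k => modalState lam b₁ (fun τ j => (u τ j : ℂ)) (t k) i := by
  ext i k
  have := congrFun (trajectory_modal h B u (t k)) i
  rw [hB, modalState_add_smul] at this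
  exact this

/-- The first `l` snapshots, restricted to the retained modes, already form an almost surely
invertible block. The rows of `b` used here come from one fixed `B`; applied with `B 0`, this gives
a null set that does not depend on `ε`. -/
theorem ae_exists_right_inverse {Ω : Type*} [MeasurableSpace Ω] {μ : Measure Ω}
    [IsProbabilityMeasure μ] {m : ℕ} {u : ℕ → Ω → Fin p → ℝ} {r : ℝ≥0}
    (hu : IsGaussianWhiteNoise μ u r) (h : IsEigendecomposition A V lam U)
    {B : Matrix (Fin N) (Fin p) ℝ} {s : Finset (Fin N)} (hctrl : ControllableModes A B U s)
    {e : Fin l → Fin N} (he : Function.Injective e) (hes : ∀ i, e i ∈ s)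
    {b : Matrix (Fin N) (Fin p) ℂ} (hb : ∀ i ∈ s, ∀ j, b i j = (Uᵀ * cplx B) i j)
    {t : Fin m → ℕ} (ht : StrictMono t) (ht1 : ∀ k, 1 ≤ t k) (hm : l ≤ m) :
    ∀ᵐ ω ∂μ, ∃ F : Matrix (Fin m) (Fin l) ℂ,
      (Matrix.of fun i k => modalState lam b (fun τ j => (u τ ω j : ℂ)) (t k) i).submatrix e id *
        F = 1 := by
  -- An eigenvector `y` of the retained diagonal system lifts to the left eigenvector `∑ y_i U_{e
  -- i}` of `A`, nonzero by biorthogonality.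
  have hpbh : ∀ y : Fin l → ℂ, y ≠ 0 → (∃ z : ℂ, (lam ∘ e) * y = z • y) →
      y ᵥ* b.submatrix e id ≠ 0 := by
    rintro y hy ⟨z, hz⟩
    have hw : y ᵥ* (Uᵀ).submatrix e id ≠ 0 := by
      intro h0
      apply hy
      have h1 : (Uᵀ).submatrix e id * V.submatrix id e = 1 := by
        rw [← Matrix.submatrix_mul _ _ _ _ _ Function.bijective_id, h.biorthogonal,
          Matrix.submatrix_one _ he]
      rw [← Matrix.vecMul_one y, ← h1, ← Matrix.vecMul_vecMul, h0, Matrix.zero_vecMul]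
    have hspan : y ᵥ* (Uᵀ).submatrix e id ∈
        Submodule.span ℂ ((fun i => U.col i) '' (s : Set (Fin N))) := by
      rw [Matrix.vecMul_eq_sum]
      refine Submodule.sum_mem _ fun i _ => Submodule.smul_mem _ _ (Submodule.subset_span ?_)
      exact ⟨e i, hes i, rfl⟩
    have hsub : ∀ {k : ℕ} (M : Matrix (Fin N) (Fin k) ℂ),
        (y ᵥ* (Uᵀ).submatrix e id) ᵥ* M = y ᵥ* (Uᵀ * M).submatrix e id := by
      intro k M
      rw [Matrix.vecMul_vecMul, Matrix.submatrix_mul _ M e id id Function.bijective_id,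
        Matrix.submatrix_id_id]
    have hne := hctrl _ hspan hw ⟨z, by
      rw [hsub, h.transpose_mul, ← Matrix.smul_vecMul, ← hz]
      ext j
      simp only [Matrix.vecMul, dotProduct, Matrix.submatrix_apply, Matrix.diagonal_mul, id,
        Pi.mul_apply, Function.comp_apply]
      exact Finset.sum_congr rfl fun i _ => by ring⟩
    rw [hsub] at hne
    have hbe : b.submatrix e id = (Uᵀ * cplx B).submatrix e id := by
      ext i j
      exact hb (e i) (hes i) j
    rwa [hbe]
  filter_upwards [ae_det_modalState_ne_zero hu (lam ∘ e) (b.submatrix e id) hpbh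
    (fun k => t (Fin.castLE hm k)) (fun i j hij => ht (by simpa using hij)) (fun k => ht1 _)]
    with ω hω
  set Q := Matrix.of fun i k =>
    modalState (lam ∘ e) (b.submatrix e id) (fun τ j => (u τ ω j : ℂ)) (t (Fin.castLE hm k)) i
    with hQ
  refine ⟨(1 : Matrix (Fin m) (Fin m) ℂ).submatrix id (Fin.castLE hm) * Q⁻¹, ?_⟩
  rw [← Matrix.mul_assoc]
  have : (Matrix.of fun i k => modalState lam b (fun τ j => (u τ ω j : ℂ)) (t k) i).submatrix e id *
      (1 : Matrix (Fin m) (Fin m) ℂ).submatrix id (Fin.castLE hm) = Q := by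
    rw [← Matrix.submatrix_mul _ _ _ _ _ Function.bijective_id, Matrix.mul_one]
    ext i k
    exact modalState_comp _ _ _ _ _ _
  rw [this, Matrix.mul_nonsing_inv _ (isUnit_iff_ne_zero.2 hω)]

theorem norm_diagonal_pow_le_one {d : Fin l → ℂ} (hd : ‖d‖ ≤ 1) (i : ℕ) :
    ‖Matrix.diagonal d ^ i‖ ≤ 1 := by
  rw [Matrix.diagonal_pow, Matrix.l2_opNorm_diagonal]
  refine (pi_norm_le_iff_of_nonneg zero_le_one).2 fun j => ?_
  rw [Pi.pow_apply, norm_pow]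
  exact pow_le_one₀ (norm_nonneg _) ((norm_le_pi_norm d j).trans hd)

/-- Only the modes in `c ∩ o` contribute to `Y' Λ^i W` up to order `ε` if `Y` and `W` are of order
`ε` outside `o` and `c`. -/
theorem exists_norm_modal_sub_le {a b : ℕ} (hlam : ‖lam‖ ≤ 1) {c o : Finset (Fin N)}
    {e : Fin l → Fin N} (he : Function.Injective e) (hes : ∀ j, j ∈ Set.range e ↔ j ∈ c ∩ o)
    (Y₀ Y₁ : Matrix (Fin N) (Fin a) ℂ) (W₀ W₁ : Matrix (Fin N) (Fin b) ℂ)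
    (hY₀ : ∀ j ∉ o, ∀ k, Y₀ j k = 0) (hW₀ : ∀ j ∉ c, ∀ k, W₀ j k = 0) :
    ∃ K, 0 ≤ K ∧ ∀ ε : ℝ, |ε| ≤ 1 → ∀ i : ℕ,
      ‖(Y₀ + (ε : ℂ) • Y₁)ᵀ * Matrix.diagonal lam ^ i * (W₀ + (ε : ℂ) • W₁) -
        (Y₀.submatrix e id)ᵀ * Matrix.diagonal (lam ∘ e) ^ i * W₀.submatrix e id‖ ≤ K * |ε| := by
  have hmain : ∀ i : ℕ, Y₀ᵀ * Matrix.diagonal lam ^ i * W₀ =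
      (Y₀.submatrix e id)ᵀ * Matrix.diagonal (lam ∘ e) ^ i * W₀.submatrix e id := by
    intro i
    rw [Matrix.diagonal_pow, Matrix.diagonal_pow]
    ext x y
    rw [Matrix.mul_apply, Matrix.mul_apply]
    simp only [Matrix.mul_diagonal, Matrix.transpose_apply, Matrix.submatrix_apply, id]
    rw [← Finset.sum_subset (Finset.subset_univ (Finset.univ.image e)), Finset.sum_image he.injOn]
    · rfl
    · intro j _ hj
      have hj' : j ∉ c ∩ o := by
        rw [← hes]
        simpa using hj
      rw [Finset.mem_inter, not_and_or] at hj'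
      rcases hj' with h | h
      · rw [hW₀ j h, mul_zero]
      · rw [hY₀ j h, zero_mul, zero_mul]
  refine ⟨‖Y₁ᵀ‖ * 1 * ‖W₀‖ + ‖Y₀ᵀ‖ * 1 * ‖W₁‖ + 1 * (‖Y₁ᵀ‖ * 1 * ‖W₁‖), by positivity,
    fun ε hε i => ?_⟩
  have hexp : (Y₀ + (ε : ℂ) • Y₁)ᵀ * Matrix.diagonal lam ^ i * (W₀ + (ε : ℂ) • W₁) -
      Y₀ᵀ * Matrix.diagonal lam ^ i * W₀ =
      (ε : ℂ) • (Y₁ᵀ * Matrix.diagonal lam ^ i * W₀ + Y₀ᵀ * Matrix.diagonal lam ^ i * W₁ +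
        (ε : ℂ) • (Y₁ᵀ * Matrix.diagonal lam ^ i * W₁)) := by
    simp only [Matrix.transpose_add, Matrix.transpose_smul, Matrix.add_mul, Matrix.mul_add,
      Matrix.smul_mul, Matrix.mul_smul, smul_add]
    abel
  rw [← hmain, hexp, norm_smul, Complex.norm_real, Real.norm_eq_abs, mul_comm]
  have hd := norm_diagonal_pow_le_one hlam i
  refine mul_le_mul_of_nonneg_right ?_ (abs_nonneg ε)
  refine norm_add_le_of_le (norm_add_le_of_le
    (l2_opNorm_mul_le_of_le (l2_opNorm_mul_le_of_le le_rfl hd) le_rfl)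
    (l2_opNorm_mul_le_of_le (l2_opNorm_mul_le_of_le le_rfl hd) le_rfl)) ?_
  rw [norm_smul, Complex.norm_real, Real.norm_eq_abs]
  exact mul_le_mul hε (l2_opNorm_mul_le_of_le (l2_opNorm_mul_le_of_le le_rfl hd) le_rfl)
    (norm_nonneg _) zero_le_one

end Modal

/-! ### The algorithm under perturbation -/

section POD

variable {N p q m n l : ℕ}

/-- The weights `R_r Σ_r^{-1/2}` that combine snapshots into the basis `T_r`. -/
noncomputable def podWeight (hm : l ≤ m) (s : ℕ → ℝ) (R : Matrix (Fin m) (Fin m) ℝ) :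
    Matrix (Fin m) (Fin l) ℝ :=
  R.submatrix id (Fin.castLE hm) * Matrix.diagonal fun k : Fin l => (√(s k))⁻¹

theorem podT_eq (hm : l ≤ m) (X : Matrix (Fin N) (Fin m) ℝ) (s : ℕ → ℝ)
    (R : Matrix (Fin m) (Fin m) ℝ) : podT hm X s R = X * podWeight hm s R :=
  Matrix.mul_assoc _ _ _

theorem podS_eq (hn : l ≤ n) (Z : Matrix (Fin N) (Fin n) ℝ) (s : ℕ → ℝ)
    (L : Matrix (Fin n) (Fin n) ℝ) : podS hn Z s L = (podWeight hn s L)ᵀ * Zᵀ := by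
  rw [podS, podWeight, Matrix.transpose_mul, Matrix.diagonal_transpose]

theorem norm_cplx_podWeight_le (hm : l ≤ m) {s : ℕ → ℝ} {R : Matrix (Fin m) (Fin m) ℝ}
    (hR : Rᵀ * R = 1) {σ : ℝ} (hσ : 0 ≤ σ) (hs : ∀ k < l, (√(s k))⁻¹ ≤ σ) :
    ‖cplx (podWeight hm s R)‖ ≤ σ ∧ ‖cplx (podWeight hm s R)ᵀ‖ ≤ σ := by
  have h1 : ‖cplx (podWeight hm s R)‖ ≤ σ := by
    rw [podWeight, cplx_mul]
    have h2 : ‖cplx (Matrix.diagonal fun k : Fin l => (√(s k))⁻¹)‖ ≤ σ := by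
      have h3 : cplx (Matrix.diagonal fun k : Fin l => (√(s k))⁻¹) =
          Matrix.diagonal fun k : Fin l => (((√(s k))⁻¹ : ℝ) : ℂ) :=
        Matrix.diagonal_map Complex.ofReal_zero
      rw [h3, Matrix.l2_opNorm_diagonal]
      refine (pi_norm_le_iff_of_nonneg hσ).2 fun k => ?_
      rw [Complex.norm_real, Real.norm_of_nonneg (by positivity)]
      exact hs k k.2
    simpa using l2_opNorm_mul_le_of_le (norm_cplx_le_one (submatrix_orthogonal hm hR)) h2
  refine ⟨h1, ?_⟩
  have h2 : cplx (podWeight hm s R)ᵀ = (cplx (podWeight hm s R))ᴴ := by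
    ext i j; simp
  rwa [h2, Matrix.l2_opNorm_conjTranspose]

theorem IsSVD.podWeight_transpose_mul_mul_podWeight (hm : l ≤ m) (hn : l ≤ n)
    {H : Matrix (Fin n) (Fin m) ℝ} {L : Matrix (Fin n) (Fin n) ℝ} {s : ℕ → ℝ}
    {R : Matrix (Fin m) (Fin m) ℝ} (h : IsSVD H L s R) (hs : ∀ k < l, 0 < s k) :
    (podWeight hn s L)ᵀ * H * podWeight hm s R = 1 := by
  set Sg : Matrix (Fin n) (Fin m) ℝ :=
    Matrix.of fun (i : Fin n) (j : Fin m) => if (i : ℕ) = j then s i else 0 with hSg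
  have h1 : (L.submatrix id (Fin.castLE hn))ᵀ * H * R.submatrix id (Fin.castLE hm) =
      Matrix.diagonal fun k : Fin l => s k := by
    have h2 : Lᵀ * H * R = Sg := by
      rw [h.eq]
      calc Lᵀ * (L * Sg * Rᵀ) * R = (Lᵀ * L) * Sg * (Rᵀ * R) := by simp only [Matrix.mul_assoc]
        _ = Sg := by rw [h.left_orthogonal, h.right_orthogonal, Matrix.one_mul, Matrix.mul_one]
    have h3 : (L.submatrix id (Fin.castLE hn))ᵀ * H * R.submatrix id (Fin.castLE hm) =
        (Lᵀ * H * R).submatrix (Fin.castLE hn) (Fin.castLE hm) := by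
      rw [Matrix.submatrix_mul _ R _ id _ Function.bijective_id,
        Matrix.submatrix_mul _ H _ id _ Function.bijective_id]
      rfl
    rw [h3, h2]
    ext i j
    simp [hSg, Matrix.diagonal_apply, Fin.ext_iff]
  rw [podWeight, podWeight, Matrix.transpose_mul, Matrix.diagonal_transpose]
  calc (Matrix.diagonal fun k : Fin l => (√(s k))⁻¹) * (L.submatrix id (Fin.castLE hn))ᵀ * H *
        (R.submatrix id (Fin.castLE hm) * Matrix.diagonal fun k : Fin l => (√(s k))⁻¹)
      = (Matrix.diagonal fun k : Fin l => (√(s k))⁻¹) *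
        ((L.submatrix id (Fin.castLE hn))ᵀ * H * R.submatrix id (Fin.castLE hm)) *
        Matrix.diagonal fun k : Fin l => (√(s k))⁻¹ := by simp only [Matrix.mul_assoc]
    _ = 1 := by
      rw [h1, Matrix.diagonal_mul_diagonal, Matrix.diagonal_mul_diagonal, ← Matrix.diagonal_one]
      congr 1
      ext k
      have hk := Real.sqrt_pos.2 (hs k k.2)
      nth_rewrite 2 [← Real.mul_self_sqrt (hs k k.2).le]
      field_simp

theorem le_rank_of_mul_mul_eq_one {E' : Matrix (Fin l) (Fin n) ℝ} {H : Matrix (Fin n) (Fin m) ℝ}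
    {E : Matrix (Fin m) (Fin l) ℝ} (h : E' * H * E = 1) : l ≤ H.rank := by
  have h1 : (1 : Matrix (Fin l) (Fin l) ℝ).rank ≤ H.rank := by
    rw [← h]
    exact (Matrix.rank_mul_le_left _ _).trans (Matrix.rank_mul_le_right _ _)
  simpa using h1

/-- Markov parameters are invariant under a change of basis, so the choice of `P` is immaterial. -/
theorem mul_conj_pow_mul {S : Matrix (Fin l) (Fin N) ℂ} {A : Matrix (Fin N) (Fin N) ℂ}
    {T : Matrix (Fin N) (Fin l) ℂ} {B : Matrix (Fin N) (Fin p) ℂ} {C : Matrix (Fin q) (Fin N) ℂ}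
    {P : Matrix (Fin l) (Fin l) ℂ} (hP : IsUnit P) (i : ℕ) :
    C * (T * P) * (P⁻¹ * S * A * (T * P)) ^ i * (P⁻¹ * S * B) = C * T * (S * A * T) ^ i * (S * B) := by
  have h1 : P * P⁻¹ = 1 := Matrix.mul_nonsing_inv _ ((Matrix.isUnit_iff_isUnit_det _).1 hP)
  have h2 : ∀ i : ℕ, P * (P⁻¹ * S * A * (T * P)) ^ i * P⁻¹ = (S * A * T) ^ i := by
    intro i
    induction i with
    | zero => simp [h1]
    | succ i ih =>
      rw [pow_succ', pow_succ', ← ih]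
      calc P * (P⁻¹ * S * A * (T * P) * (P⁻¹ * S * A * (T * P)) ^ i) * P⁻¹
          = (P * P⁻¹) * S * A * T * (P * (P⁻¹ * S * A * (T * P)) ^ i * P⁻¹) := by
            simp only [Matrix.mul_assoc]
        _ = _ := by rw [h1, Matrix.one_mul]
  rw [← h2 i]
  simp only [Matrix.mul_assoc]

/-- The RPOD* algorithm near a factorization of the data through `ℂ^l`. -/
theorem rpod_perturbation (hm : l ≤ m) (hn : l ≤ n)
    {A : Matrix (Fin N) (Fin N) ℝ} {B : Matrix (Fin N) (Fin p) ℝ} {C : Matrix (Fin q) (Fin N) ℝ}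
    {X : Matrix (Fin N) (Fin m) ℝ} {Z : Matrix (Fin N) (Fin n) ℝ}
    {X₀ : Matrix (Fin l) (Fin m) ℂ} {Z₀ : Matrix (Fin n) (Fin l) ℂ} {d : Fin l → ℂ}
    {B₀ : Matrix (Fin l) (Fin p) ℂ} {C₀ : Matrix (Fin q) (Fin l) ℂ}
    {G : Matrix (Fin l) (Fin n) ℂ} {F : Matrix (Fin m) (Fin l) ℂ} {β γ ρ δ η : ℝ}
    (hG : G * Z₀ = 1) (hF : X₀ * F = 1) (hγ : 0 < γ) (hGF : ‖G‖ * ‖F‖ ≤ γ)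
    (hγβ : √(2 * γ) ≤ β) (hβ : 1 ≤ β) (hρ : ρ < 1)
    (hX : ‖X₀‖ ≤ β) (hZ : ‖Z₀‖ ≤ β) (hD : ‖Matrix.diagonal d‖ ≤ ρ) (hB : ‖B₀‖ ≤ β)
    (hC : ‖C₀‖ ≤ β)
    (hηγ : γ * η ≤ 1 / 2) (hη : β ^ 2 * η ≤ 1 / 2) (hηρ : 4 * β ^ 6 * η ≤ (1 - ρ) / 2)
    (hηδ : 4 * β ^ 6 * η < δ)
    (hdiag : Function.Injective d → ∀ M : Matrix (Fin l) (Fin l) ℂ, ‖M - Matrix.diagonal d‖ < δ →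
      ∃ (P : Matrix (Fin l) (Fin l) ℂ) (μ : Fin l → ℂ),
        IsUnit P ∧ M = P * Matrix.diagonal μ * P⁻¹)
    (hH : ‖cplx (Zᵀ * X) - Z₀ * X₀‖ ≤ η)
    (hHA : ‖cplx (Zᵀ * A * X) - Z₀ * Matrix.diagonal d * X₀‖ ≤ η)
    (hHB : ‖cplx (Zᵀ * B) - Z₀ * B₀‖ ≤ η) (hHC : ‖cplx (C * X) - C₀ * X₀‖ ≤ η)
    (hmarkov : ∀ i : ℕ, ‖cplx (C * A ^ i * B) - C₀ * Matrix.diagonal d ^ i * B₀‖ ≤ η) :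
    l ≤ (Zᵀ * X).rank ∧
      (Function.Injective d → ∃ Ar Br Cr, IsRPODStarROM hm hn A B C X Z Ar Br Cr) ∧
      ∀ Ar Br Cr, IsRPODStarROM hm hn A B C X Z Ar Br Cr →
        ∀ i : ℕ, ‖Cr * Ar ^ i * Br - cplx (C * A ^ i * B)‖ ≤
          (6 * β ^ 8 + 24 * β ^ 12 / (1 - ρ) + 3 * β ^ 8 + 1) * η := by
  have hη0 : 0 ≤ η := (norm_nonneg _).trans hH
  -- With `‖1 - G H F‖ ≤ 1 / 2` the singular value bound leaves `γ * s k ≥ 1 / 2`. Hence the weights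
  -- are at most `√(2 * γ) ≤ β` for every choice of decomposition.
  have hs : ∀ {L s R}, IsSVD (Zᵀ * X) L s R → ∀ k < l, 1 / (2 * γ) ≤ s k := by
    intro L s R h k hk
    have h1 := one_le_norm_one_sub_add_singularValue h G F hk
    have h2 : ‖1 - G * cplx (Zᵀ * X) * F‖ ≤ 1 / 2 := by
      have h3 : 1 - G * cplx (Zᵀ * X) * F = -(G * (cplx (Zᵀ * X) - Z₀ * X₀) * F) := by
        rw [Matrix.mul_sub, Matrix.sub_mul, ← Matrix.mul_assoc G, hG, Matrix.one_mul, hF]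
        abel
      rw [h3, norm_neg]
      refine (l2_opNorm_mul_le_of_le (l2_opNorm_mul_le_of_le le_rfl hH) le_rfl).trans ?_
      have := mul_le_mul_of_nonneg_right hGF hη0
      linarith
    have h4 := mul_le_mul_of_nonneg_right hGF (h.nonneg k)
    rw [div_le_iff₀ (by positivity)]
    linarith
  have hpos : ∀ {L s R}, IsSVD (Zᵀ * X) L s R → ∀ k < l, 0 < s k := fun h k hk =>
    lt_of_lt_of_le (by positivity) (hs h k hk)
  have hweight : ∀ {L s R}, IsSVD (Zᵀ * X) L s R → ∀ k < l, (√(s k))⁻¹ ≤ β := by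
    intro L s R h k hk
    refine le_trans ?_ hγβ
    rw [← Real.sqrt_inv]
    apply Real.sqrt_le_sqrt
    rw [inv_le_comm₀ (hpos h k hk) (by positivity), ← one_div]
    exact hs h k hk
  have hone : ∀ {L s R}, IsSVD (Zᵀ * X) L s R →
      cplx (podWeight hn s L)ᵀ * cplx (Zᵀ * X) * cplx (podWeight hm s R) = 1 := by
    intro L s R h
    rw [← cplx_mul, ← cplx_mul, h.podWeight_transpose_mul_mul_podWeight hm hn (hpos h)]
    exact Matrix.map_one _ Complex.ofReal_zero Complex.ofReal_one
  have hSAT : ∀ (L : Matrix (Fin n) (Fin n) ℝ) (s : ℕ → ℝ) (R : Matrix (Fin m) (Fin m) ℝ),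
      cplx (podS hn Z s L) * cplx A * cplx (podT hm X s R) =
      cplx (podWeight hn s L)ᵀ * cplx (Zᵀ * A * X) * cplx (podWeight hm s R) := by
    intro L s R
    rw [podS_eq, podT_eq]
    simp only [cplx_mul, Matrix.mul_assoc]
  obtain ⟨L, s, R, hsvd⟩ := exists_isSVD (Zᵀ * X)
  have hβ0 : 0 ≤ β := by linarith
  refine ⟨le_rank_of_mul_mul_eq_one
    (hsvd.podWeight_transpose_mul_mul_podWeight hm hn (hpos hsvd)), fun hd => ?_, ?_⟩
  · obtain ⟨J, hTJ, hJT, -, -, hM⟩ := exists_approximate_similarity hη hX hZ (hD.trans hρ.le)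
      (norm_cplx_podWeight_le hm hsvd.right_orthogonal hβ0 (hweight hsvd)).1
      (norm_cplx_podWeight_le hn hsvd.left_orthogonal hβ0 (hweight hsvd)).2 (hone hsvd) hH hHA
    obtain ⟨P, μ, hP, hPM⟩ := hdiag hd _ (hM.trans_lt hηδ)
    have hJunit : IsUnit J := ⟨⟨J, _, hJT, hTJ⟩, rfl⟩
    have hJinv : J⁻¹ = X₀ * cplx (podWeight hm s R) := Matrix.inv_eq_left_inv hTJ
    -- It is the conjugate of the reduced dynamics by `X₀ E = J⁻¹` that is close to `diagonal d`;
    -- its eigenvectors `P` are carried back by `J`.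
    refine ⟨_, _, _, L, s, R, J * P, μ, hsvd, hpos hsvd, hJunit.mul hP, ?_, rfl, rfl, rfl⟩
    rw [cplx_mul, cplx_mul, hSAT]
    set W := cplx (podWeight hn s L)ᵀ * cplx (Zᵀ * A * X) * cplx (podWeight hm s R)
    have h1 : J * P * Matrix.diagonal μ * (J * P)⁻¹ = J * (P * Matrix.diagonal μ * P⁻¹) * J⁻¹ := by
      rw [Matrix.mul_inv_rev]
      simp only [Matrix.mul_assoc]
    rw [h1, ← hPM, hJinv]
    calc W = J * (X₀ * cplx (podWeight hm s R)) * W * (J * (X₀ * cplx (podWeight hm s R))) := by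
          rw [hJT, one_mul, mul_one]
      _ = _ := by simp only [Matrix.mul_assoc]
  · rintro Ar Br Cr ⟨L, s, R, P, μ, h, -, hP, -, rfl, rfl, rfl⟩ i
    have h1 : cplx C * (cplx (podT hm X s R) * P) *
        (P⁻¹ * cplx (podS hn Z s L) * cplx A * (cplx (podT hm X s R) * P)) ^ i *
        (P⁻¹ * cplx (podS hn Z s L) * cplx B) =
        cplx (C * X) * cplx (podWeight hm s R) *
          (cplx (podWeight hn s L)ᵀ * cplx (Zᵀ * A * X) * cplx (podWeight hm s R)) ^ i *
          (cplx (podWeight hn s L)ᵀ * cplx (Zᵀ * B)) := by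
      rw [mul_conj_pow_mul hP, hSAT, podS_eq, podT_eq]
      simp only [cplx_mul, Matrix.mul_assoc]
    have h2 := norm_reduced_markov_sub_le hβ hρ hη hηρ hX hZ hD hB hC
      (norm_cplx_podWeight_le hm h.right_orthogonal hβ0 (hweight h)).1
      (norm_cplx_podWeight_le hn h.left_orthogonal hβ0 (hweight h)).2 (hone h) hH hHA hHB hHC i
    rw [h1]
    -- Both sets of Markov parameters are compared with those of the limit model; the true system
    -- contributes the `+ 1` in the constant.
    have h3 := norm_sub_le_of_le h2 (hmarkov i)
    rw [sub_sub_sub_cancel_right] at h3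
    exact h3.trans (le_of_eq (by ring))

end POD

/-! ### Choice of constants and conclusion -/

theorem exists_pos_forall_mul_abs_lt (a b K : ℝ) (hb : 0 < b) :
    ∃ ε₀ > 0, ∀ ε : ℝ, |ε| < ε₀ → a * (K * |ε|) < b := by
  have hcont : Continuous fun ε : ℝ => a * (K * |ε|) := by fun_prop
  have hev : ∀ᶠ ε in nhds (0 : ℝ), a * (K * |ε|) < b :=
    hcont.continuousAt.eventually_lt continuousAt_const (by simpa using hb)
  obtain ⟨ε₀, hε₀, h⟩ := Metric.eventually_nhds_iff.1 hev
  exact ⟨ε₀, hε₀, fun ε hε => h (by simpa using hε)⟩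

theorem proposition3 {N p q m n l : ℕ}
    (A : Matrix (Fin N) (Fin N) ℝ)
    (B : ℝ → Matrix (Fin N) (Fin p) ℝ) (C : ℝ → Matrix (Fin q) (Fin N) ℝ)
    (V U : Matrix (Fin N) (Fin N) ℂ) (lam : Fin N → ℂ)
    (hstable : IsStableMatrix A) (hdiag : IsEigendecomposition A V lam U)
    -- the controllable modes `c` and the observable modes `o`, up to couplings of order `ε`
    (c o : Finset (Fin N)) (hl : (c ∩ o).card = l)
    (hB : NearlyUncontrollable U c B) (hC : NearlyUnobservable V o C)
    (hctrl : ControllableModes A (B 0) U (c ∩ o)) (hobs : ObservableModes A (C 0) V (c ∩ o))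
    -- the white noise inputs and the snapshot times
    {Ω : Type*} [MeasurableSpace Ω] (μ : Measure Ω) [IsProbabilityMeasure μ]
    (u : ℕ → Ω → Fin p → ℝ) (v : ℕ → Ω → Fin q → ℝ) (ru rv : ℝ≥0)
    (hu : IsGaussianWhiteNoise μ u ru) (hv : IsGaussianWhiteNoise μ v rv)
    (t : Fin m → ℕ) (ht : StrictMono t) (ht1 : ∀ k, 1 ≤ t k)
    (t' : Fin n → ℕ) (ht' : StrictMono t') (ht1' : ∀ k, 1 ≤ t' k)
    (hm : l ≤ m) (hn : l ≤ n) :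
    ∀ᵐ ω ∂μ, ∃ K : ℝ, ∃ ε₀ > 0, ∀ ε : ℝ, |ε| < ε₀ →
      ∀ (X : Matrix (Fin N) (Fin m) ℝ) (Z : Matrix (Fin N) (Fin n) ℝ),
        X = snapshots A (B ε) (fun k => u k ω) t →
        Z = snapshots Aᵀ (C ε)ᵀ (fun k => v k ω) t' →
        -- there are `l` nonzero singular values to keep
        l ≤ (Zᵀ * X).rank ∧
        -- the algorithm returns a reduced order model when the retained modes are simple
        (Set.InjOn lam (c ∩ o : Finset (Fin N)) →
          ∃ Ar Br Cr, IsRPODStarROM hm hn A (B ε) (C ε) X Z Ar Br Cr) ∧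
        -- the Markov parameters of every returned model are accurate to order `ε`
        ∀ Ar Br Cr, IsRPODStarROM hm hn A (B ε) (C ε) X Z Ar Br Cr →
          ∀ i : ℕ, ‖Cr * Ar ^ i * Br - cplx (C ε * A ^ i * B ε)‖ ≤ K * |ε| := by
  obtain ⟨b₀, b₁, hb₀, hb₀c, hb⟩ := hB.exists_eq_add_smul
  obtain ⟨c₀, c₁, hc₀, hc₀o, hc⟩ := hC.transpose.exists_eq_add_smul
  let es : Fin l ≃ (c ∩ o : Finset (Fin N)) := (Finset.equivFinOfCardEq hl).symm
  let e : Fin l → Fin N := fun i => es i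
  have he : Function.Injective e := Subtype.val_injective.comp es.injective
  have hec : ∀ i, e i ∈ c ∩ o := fun i => (es i).2
  have hes : ∀ j, j ∈ Set.range e ↔ j ∈ c ∩ o := by
    refine fun j => ⟨?_, fun hj => ⟨es.symm ⟨j, hj⟩, by simp [e]⟩⟩
    rintro ⟨i, rfl⟩
    exact hec i
  have hlam := hdiag.norm_lt_one hstable
  filter_upwards [ae_exists_right_inverse hu hdiag hctrl he hec
      (fun i hi => hb₀c i (Finset.mem_inter.1 hi).1) ht ht1 hm,
    ae_exists_right_inverse hv hdiag.transpose hobs.transpose he hec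
      (fun i hi => hc₀o i (Finset.mem_inter.1 hi).2) ht' ht1' hn] with ω hF hG
  obtain ⟨F, hF⟩ := hF
  obtain ⟨G, hG⟩ := hG
  set x₀ : Matrix (Fin N) (Fin m) ℂ :=
    Matrix.of fun i k => modalState lam b₀ (fun τ j => (u τ ω j : ℂ)) (t k) i with hx₀
  set x₁ : Matrix (Fin N) (Fin m) ℂ :=
    Matrix.of fun i k => modalState lam b₁ (fun τ j => (u τ ω j : ℂ)) (t k) i with hx₁
  set z₀ : Matrix (Fin N) (Fin n) ℂ :=
    Matrix.of fun i k => modalState lam c₀ (fun τ j => (v τ ω j : ℂ)) (t' k) i with hz₀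
  set z₁ : Matrix (Fin N) (Fin n) ℂ :=
    Matrix.of fun i k => modalState lam c₁ (fun τ j => (v τ ω j : ℂ)) (t' k) i with hz₁
  have hx₀c : ∀ j ∉ c, ∀ k, x₀ j k = 0 := fun j hj k => modalState_eq_zero lam (hb₀ j hj) _ _
  have hz₀o : ∀ j ∉ o, ∀ k, z₀ j k = 0 := fun j hj k => modalState_eq_zero lam (hc₀ j hj) _ _
  have hX : ∀ ε : ℝ, Uᵀ * cplx (snapshots A (B ε) (fun k => u k ω) t) = x₀ + (ε : ℂ) • x₁ :=
    fun ε => snapshots_modal hdiag (hb ε) _ _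
  have hZ : ∀ ε : ℝ, Vᵀ * cplx (snapshots Aᵀ (C ε)ᵀ (fun k => v k ω) t') = z₀ + (ε : ℂ) • z₁ :=
    fun ε => snapshots_modal hdiag.transpose (hc ε) _ _
  obtain ⟨K₁, hK₁, h₁⟩ := exists_norm_modal_sub_le hlam.le he hes z₀ z₁ x₀ x₁ hz₀o hx₀c
  obtain ⟨K₂, hK₂, h₂⟩ := exists_norm_modal_sub_le hlam.le he hes z₀ z₁ b₀ b₁ hz₀o hb₀
  obtain ⟨K₃, hK₃, h₃⟩ := exists_norm_modal_sub_le hlam.le he hes c₀ c₁ x₀ x₁ hc₀ hx₀c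
  obtain ⟨K₄, hK₄, h₄⟩ := exists_norm_modal_sub_le hlam.le he hes c₀ c₁ b₀ b₁ hc₀ hb₀
  have hfactor : ∀ {a b : ℕ} {Y : Matrix (Fin N) (Fin a) ℝ} {W : Matrix (Fin N) (Fin b) ℝ}
      {y w : Matrix (Fin N) _ ℂ}, Vᵀ * cplx Y = y → Uᵀ * cplx W = w → ∀ i : ℕ,
      cplx Yᵀ * cplx A ^ i * cplx W = yᵀ * Matrix.diagonal lam ^ i * w := by
    rintro a b Y W _ _ rfl rfl i
    rw [hdiag.pow_eq, cplx_transpose, Matrix.transpose_mul, Matrix.transpose_transpose]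
    simp only [Matrix.mul_assoc]
  set K := K₁ + K₂ + K₃ + K₄ with hK
  set D := Matrix.diagonal (lam ∘ e) with hD
  have hDn : ‖D‖ ≤ ‖lam‖ := by
    rw [hD, Matrix.l2_opNorm_diagonal]
    exact (pi_norm_le_iff_of_nonneg (norm_nonneg _)).2 fun i => norm_le_pi_norm lam (e i)
  set X₀ := x₀.submatrix e id with hX₀
  set Z₀ := (z₀.submatrix e id)ᵀ with hZ₀
  set B₀ := b₀.submatrix e id with hB₀
  set C₀ := (c₀.submatrix e id)ᵀ with hC₀
  have hG' : Gᵀ * Z₀ = 1 := by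
    rw [hZ₀, ← Matrix.transpose_mul, hG, Matrix.transpose_one]
  -- The added 1 keeps `γ` positive even if the norms vanish, as for `l = 0`.
  set γ := ‖Gᵀ‖ * ‖F‖ + 1 with hγ
  have hγ0 : 0 < γ := by positivity
  set β := 1 + ‖X₀‖ + ‖Z₀‖ + ‖B₀‖ + ‖C₀‖ + √(2 * γ) with hβ
  have hsq := Real.sqrt_nonneg (2 * γ)
  have hX₀n := norm_nonneg X₀
  have hZ₀n := norm_nonneg Z₀
  have hB₀n := norm_nonneg B₀
  have hC₀n := norm_nonneg C₀
  obtain ⟨δ, hδ, hdiagonalizable⟩ : ∃ δ > 0, Function.Injective (lam ∘ e) →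
      ∀ M : Matrix (Fin l) (Fin l) ℂ, ‖M - D‖ < δ →
        ∃ (P : Matrix (Fin l) (Fin l) ℂ) (μ : Fin l → ℂ),
          IsUnit P ∧ M = P * Matrix.diagonal μ * P⁻¹ := by
    by_cases hinj : Function.Injective (lam ∘ e)
    · obtain ⟨δ, hδ, h⟩ := exists_forall_diagonalizable hinj
      exact ⟨δ, hδ, fun _ => h⟩
    -- With repeated eigenvalues no existence is claimed, so any `δ` will do.
    · exact ⟨1, one_pos, fun h => absurd h hinj⟩
  -- The four thresholds are the smallness conditions of `rpod_perturbation` for `η = K * |ε|`; `|ε|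
  -- < 1` serves the `ε²` terms.
  obtain ⟨ε₁, hε₁, hs₁⟩ := exists_pos_forall_mul_abs_lt γ (1 / 2) K (by norm_num)
  obtain ⟨ε₂, hε₂, hs₂⟩ := exists_pos_forall_mul_abs_lt (β ^ 2) (1 / 2) K (by norm_num)
  obtain ⟨ε₃, hε₃, hs₃⟩ := exists_pos_forall_mul_abs_lt (4 * β ^ 6) ((1 - ‖lam‖) / 2) K
    (by linarith)
  obtain ⟨ε₄, hε₄, hs₄⟩ := exists_pos_forall_mul_abs_lt (4 * β ^ 6) δ K hδ
  refine ⟨(6 * β ^ 8 + 24 * β ^ 12 / (1 - ‖lam‖) + 3 * β ^ 8 + 1) * K,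
    min 1 (min (min ε₁ ε₂) (min ε₃ ε₄)), by positivity, ?_⟩
  rintro ε hε X Z rfl rfl
  simp only [lt_min_iff] at hε
  obtain ⟨hε1, ⟨hε₁', hε₂'⟩, hε₃', hε₄'⟩ := hε
  have hle : ∀ {x K' : ℝ}, x ≤ K' * |ε| → K' ≤ K → x ≤ K * |ε| := fun h h' =>
    h.trans (mul_le_mul_of_nonneg_right h' (abs_nonneg ε))
  have hmain := rpod_perturbation hm hn (A := A) (B := B ε) (C := C ε) (d := lam ∘ e)
    (η := K * |ε|) hG' hF hγ0 (by linarith) (by linarith : √(2 * γ) ≤ β) (by linarith) hlam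
    (by linarith : ‖X₀‖ ≤ β) (by linarith : ‖Z₀‖ ≤ β) hDn (by linarith : ‖B₀‖ ≤ β)
    (by linarith : ‖C₀‖ ≤ β) (hs₁ ε hε₁').le (hs₂ ε hε₂').le (hs₃ ε hε₃').le (hs₄ ε hε₄')
    hdiagonalizable
    (by
      have h := h₁ ε hε1.le 0
      rw [← hfactor (hZ ε) (hX ε)] at h
      simp only [pow_zero, Matrix.mul_one] at h
      rw [cplx_mul]
      exact hle h (by linarith))
    (by
      have h := h₁ ε hε1.le 1
      rw [← hfactor (hZ ε) (hX ε)] at h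
      simp only [pow_one] at h
      rw [cplx_mul, cplx_mul]
      exact hle h (by linarith))
    (by
      have h := h₂ ε hε1.le 0
      rw [← hfactor (hZ ε) (hb ε)] at h
      simp only [pow_zero, Matrix.mul_one] at h
      rw [cplx_mul]
      exact hle h (by linarith))
    (by
      have h := h₃ ε hε1.le 0
      rw [← hfactor (hc ε) (hX ε)] at h
      simp only [pow_zero, Matrix.mul_one, Matrix.transpose_transpose] at h
      rw [cplx_mul]
      exact hle h (by linarith))
    (by
      intro i
      have h := h₄ ε hε1.le i
      rw [← hfactor (hc ε) (hb ε), Matrix.transpose_transpose] at h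
      have hpow : cplx (A ^ i) = cplx A ^ i := map_pow Complex.ofRealHom.mapMatrix A i
      rw [cplx_mul, cplx_mul, hpow]
      exact hle h (by linarith))
  obtain ⟨hrank, hex, hacc⟩ := hmain
  refine ⟨hrank, fun hinj => hex fun i j hij => he (hinj (hec i) (hec j) hij),
    fun Ar Br Cr hrom i => ?_⟩
  rw [mul_assoc]
  exact hacc Ar Br Cr hrom i
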